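/- **Setting.** Let $A$ be a finite alphabet. A subshift $W\subseteq A^{\mathbb Z^2}$ is a closed shift-invariant set; it has a *fully supported measure* if there is a shift-invariant Borel probability measure on $W$ that gives positive mass to every nonempty relatively open subset of $W$. A pattern is an element of $A^S$ with $S\subseteq\mathbb Z^2$ finite; it appears in $x$ if some translate of it is a restriction of $x$. *Entropy.* For an open cover $\mathcal U$ of a compact metrizable $\mathbb Z^2$-system $X$ let $h(X,\mathcal U)=\lim_n n^{-2}\log\mathcal N\big(\bigvee_{g\in[0,n)^2}g^{-1}\mathcal U\big)$, where $\mathcal N$ is the least cardinality of a subcover; the topological entropy of $X$ is the supremum of $h(X,\mathcal U)$ over all open covers. $X$ has *TCPE* if every topological factor of $X$ with more than one point has positive topological entropy. Distinct points $x,y\in X$ form an *entropy pair* if $h(X,\{K^c,K'^c\})>0$ for all disjoint closed neighbourhoods $K$ of $x$ and $K'$ of $y$. *TCPE hierarchy.* $E_1\subseteq X^2$ is the set of pairs that are equal or entropy pairs. $E_{\alpha+1}$ is the closure of $E_\alpha$ if $E_\alpha$ is not closed, the transitive symmetric closure of $E_\alpha$ if $E_\alpha$ is closed but not an equivalence relation,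 and $E_\alpha$ otherwise; $E_\lambda=\bigcup_{1\le\alpha<\lambda}E_\alpha$ for limit $\lambda$. The *TCPE rank* of $X$ is the least $\alpha\in[1,\omega_1)$ with $E_\alpha=X^2$, if there is one. *Generalized transitivity hierarchy.* $T_1\subseteq W^2$ is the set of transitivity pairs: $(x,x')\in W^2$ such that any pattern $v$ appearing in $x$ and any pattern $v'$ appearing in $x'$ both appear in a common point of $W$. $T_{\alpha+1}$ is the transitive closure of $T_\alpha$ if $T_\alpha$ is closed, and the closure of $T_\alpha$ otherwise; $T_\lambda=\bigcup_{1\le\alpha<\lambda}T_\alpha$ for limit $\lambda$. $W$ is *generalized transitive* if $T_\alpha=W^2$ for some $\alpha\in[1,\omega_1)$; the least such $\alpha$ is its *generalized transitivity rank*. *The fabric map $f$.* A ribbon family is a function $R:\mathbb Z\times\mathbb Z\to\mathbb Z$, $(i,n)\mapsto R_i(n)$, with $|R_i(n+1)-R_i(n)|\le1$, $|R_i(n+2)-R_i(n)|\le 1$ and $2\le R_{i+1}(n)-R_i(n)\le4$ for all $i,n$. Given ribbon families $H,V$, the $i$-th horizontal ribbon is $\{(n,H_i(n)):n\in\mathbb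 Z\}$ and the $j$-th vertical ribbon is $\{(V_j(m),m):m\in\mathbb Z\}$; they cross at the site $(n,H_i(n))$ with $n\le V_j(H_i(n))$ and $V_j(H_i(n+1))<n+1$ (there is exactly one). Let $B=\{*,-1,0,1\}\times\{*,-1,0,1\}\times(\{*\}\cup A)$. For $x\in A^{\mathbb Z^2}$ let $f(x)\subseteq B^{\mathbb Z^2}$ be the set of all $y$ obtained, from all ribbon families $H,V$, as follows: the first coordinate of $y(n,m)$ is $H_i(n+1)-H_i(n)$ if $m=H_i(n)$ for some $i$, and $*$ otherwise; the second is $V_j(m+1)-V_j(m)$ if $n=V_j(m)$ for some $j$, and $*$ otherwise; the third is $x(j,i)$ if the $i$-th horizontal and the $j$-th vertical ribbon cross at $(n,m)$, and $*$ if no ribbons cross there. Put $f(W)=\bigcup_{x\in W}f(x)$ and $f(T)=\bigcup_{(x,x')\in T}f(x)\times f(x')$ for $T\subseteq W^2$. **Theorem.** Let $W\subseteq A^{\mathbb Z^2}$ be a subshift with a fully supported measure. Then $f(W)$ is a subshift, and $f(W)$ has TCPE if and only if $W$ is generalized transitive; in this case the TCPE rank of $f(W)$ equals the generalized transitivity rank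 of $W$. Moreover, $f(T_\alpha)=E_\alpha$ for all $\alpha\in[1,\omega_1)$, where $T_\alpha$ and $E_\alpha$ are the relations of the two hierarchies on $W$ and on $f(W)$. -/

import Mathlib

open Set Filter Topology MeasureTheory

noncomputable section

namespace Fabric

universe u v

/-! ### Configurations, patterns and subshifts over `ℤ²` -/

/-- Configurations `ℤ² → A`, with the product topology. -/
abbrev Config (A : Type u) : Type u := ℤ × ℤ → A

/-- The shift action: `(g x)(h) = x(h - g)`. -/
def shift {A : Type u} (g : ℤ × ℤ) (x : Config A) : Config A := fun h => x (h - g)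

/-- A subshift: a closed set of configurations which is invariant under all shifts. -/
structure IsSubshift {A : Type u} [TopologicalSpace A] (W : Set (Config A)) : Prop where
  isClosed : IsClosed W
  shift_mem : ∀ g : ℤ × ℤ, ∀ x ∈ W, shift g x ∈ W

/-- A pattern: a function on a finite subset of `ℤ²`. -/
structure Pattern (A : Type u) where
  supp : Finset (ℤ × ℤ)
  val : supp → A

/-- The pattern `w` appears in `x` if some translate of `w` is a restriction of `x`. -/
def Pattern.AppearsIn {A : Type u} (w : Pattern A) (x : Config A) : Prop :=
  ∃ g : ℤ × ℤ, ∀ s : w.supp, x (s.1 + g) = w.val s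

/-- `W` carries a fully supported measure: a shift-invariant Borel probability measure
concentrated on `W` and charging every nonempty relatively open subset of `W`. -/
def HasFullySupportedMeasure {A : Type u} [TopologicalSpace A] (W : Set (Config A)) : Prop :=
  letI : MeasurableSpace (Config A) := borel (Config A)
  ∃ μ : Measure (Config A), IsProbabilityMeasure μ ∧
    (∀ g : ℤ × ℤ, μ.map (shift g) = μ) ∧
    μ Wᶜ = 0 ∧
    ∀ U : Set (Config A), IsOpen U → (U ∩ W).Nonempty → 0 < μ U

/-! ### Entropy of covers, topological entropy, completely positive entropy -/

/-- The common refinement of the covers `g⁻¹ 𝒰`, for `g ∈ [0,n)²`. -/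
def coverJoin {Z : Type u} (T : ℤ × ℤ → Z → Z) (𝒰 : Set (Set Z)) (n : ℕ) : Set (Set Z) :=
  {P | ∃ c : ℤ × ℤ → Set Z, (∀ g, c g ∈ 𝒰) ∧
    P = {z | ∀ g ∈ Set.Ico (0 : ℤ) n ×ˢ Set.Ico (0 : ℤ) n, T g z ∈ c g}}

/-- The smallest cardinality of a subfamily of `𝒱` which covers `X`. -/
def minCover {Z : Type u} (X : Set Z) (𝒱 : Set (Set Z)) : ℕ :=
  sInf {k | ∃ F : Finset (Set Z), (F : Set (Set Z)) ⊆ 𝒱 ∧ X ⊆ ⋃₀ (F : Set (Set Z)) ∧ F.card = k}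

/-- The entropy `h(X, 𝒰)` of `X`, under the `ℤ²`-action `T`, relative to the cover `𝒰` of `X`.
For an open cover of a compact invariant set the limit superior is a limit. -/
def coverEntropy {Z : Type u} (T : ℤ × ℤ → Z → Z) (X : Set Z) (𝒰 : Set (Set Z)) : EReal :=
  limsup (fun n : ℕ => ((Real.log (minCover X (coverJoin T 𝒰 n)) / (n : ℝ) ^ 2 : ℝ) : EReal)) atTop

/-- The topological entropy of a `ℤ²`-action: the supremum of the entropies of open covers. -/
def topEntropy (Y : Type u) [TopologicalSpace Y] [AddAction (ℤ × ℤ) Y] : EReal :=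
  ⨆ 𝒰 : {𝒰 : Set (Set Y) // (∀ U ∈ 𝒰, IsOpen U) ∧ ⋃₀ 𝒰 = Set.univ},
    coverEntropy (fun (g : ℤ × ℤ) (y : Y) => g +ᵥ y) Set.univ 𝒰.1

/-- Topological completely positive entropy: every factor (a compact metrizable space with an
action of `ℤ²` by homeomorphisms, and a continuous equivariant surjection onto it) with more than
one point has positive topological entropy. A factor is homeomorphic to a quotient of `X`, so
nothing is lost by taking it in the universe of `X`. -/
def HasTCPE {A : Type u} [TopologicalSpace A] (X : Set (Config A)) : Prop :=
  ∀ (Y : Type u) [TopologicalSpace Y] [CompactSpace Y] [TopologicalSpace.MetrizableSpace Y]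
    [AddAction (ℤ × ℤ) Y] [ContinuousConstVAdd (ℤ × ℤ) Y] (π : X → Y),
    Continuous π → Function.Surjective π →
    (∀ (g : ℤ × ℤ) (x x' : X), x'.1 = shift g x.1 → π x' = g +ᵥ π x) →
    Nontrivial Y → 0 < topEntropy Y

/-- Entropy pairs of a subshift `X`: distinct points `x, y` such that `h(X, {Kᶜ, K'ᶜ}) > 0` for
all disjoint closed neighbourhoods `K` of `x` and `K'` of `y`. -/
def IsEntropyPair {A : Type u} [TopologicalSpace A] (X : Set (Config A)) (x y : Config A) : Prop :=
  x ∈ X ∧ y ∈ X ∧ x ≠ y ∧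
    ∀ K K' : Set (Config A), IsClosed K → IsClosed K' → K ∈ 𝓝[X] x → K' ∈ 𝓝[X] y →
      Disjoint K K' → 0 < coverEntropy shift X {Kᶜ, K'ᶜ}

/-! ### The two hierarchies of relations -/

/-- Transfinite iteration indexed from `1`: the level `1` is `base`, the level `α + 1` is `step` of
the level `α` for `α ≥ 1`, and limit levels are unions. (The level `0` is unused; by convention it
is `base` as well.) -/
def levels {P : Type u} (base : Set P) (step : Set P → Set P) (α : Ordinal.{0}) : Set P :=
  Ordinal.limitRecOn (motive := fun _ => Set P) α base
    (fun β S => open Classical in if β = 0 then base else step S)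
    (fun l _ S => ⋃ (β : Ordinal.{0}) (hβ : β < l), S β hβ)

/-- The transitive closure of a relation. -/
def transClosure {Z : Type u} (R : Set (Z × Z)) : Set (Z × Z) :=
  {p | Relation.TransGen (fun a b => (a, b) ∈ R) p.1 p.2}

/-- The transitive, symmetric closure of a relation. -/
def transSymmClosure {Z : Type u} (R : Set (Z × Z)) : Set (Z × Z) :=
  {p | Relation.TransGen (Relation.SymmGen fun a b => (a, b) ∈ R) p.1 p.2}

/-- `R` is an equivalence relation on the set `X`. -/
def IsEquivOn {Z : Type u} (X : Set Z) (R : Set (Z × Z)) : Prop :=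
  (∀ x ∈ X, (x, x) ∈ R) ∧ (∀ x y, (x, y) ∈ R → (y, x) ∈ R) ∧
    ∀ x y z, (x, y) ∈ R → (y, z) ∈ R → (x, z) ∈ R

/-- The set `E₁` of entropy-or-equal pairs of `X`. -/
def entropyOrEqual {A : Type u} [TopologicalSpace A] (X : Set (Config A)) :
    Set (Config A × Config A) :=
  {p | p.1 ∈ X ∧ p.2 ∈ X ∧ (p.1 = p.2 ∨ IsEntropyPair X p.1 p.2)}

/-- The successor step of the hierarchy `E`. -/
def entropyStep {A : Type u} [TopologicalSpace A] (X : Set (Config A))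
    (R : Set (Config A × Config A)) : Set (Config A × Config A) :=
  open Classical in
  if ¬ IsClosed R then closure R
  else if ¬ IsEquivOn X R then transSymmClosure R
  else R

/-- The relations `E_α` on `X`, for `1 ≤ α`. -/
def E {A : Type u} [TopologicalSpace A] (X : Set (Config A)) (α : Ordinal.{0}) :
    Set (Config A × Config A) :=
  levels (entropyOrEqual X) (entropyStep X) α

/-- The TCPE rank of `X`: the least `α ∈ [1, ω₁)` with `E_α = X²` (`0` if there is none). -/
def tcpeRank {A : Type u} [TopologicalSpace A] (X : Set (Config A)) : Ordinal.{0} :=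
  sInf {α | 1 ≤ α ∧ α < Ordinal.omega 1 ∧ E X α = X ×ˢ X}

/-- The set `T₁` of transitivity pairs of `W`: any two patterns appearing in `x` and in `x'`,
respectively, coexist in some point of `W`. -/
def transitivityPairs {A : Type u} (W : Set (Config A)) : Set (Config A × Config A) :=
  {p | p.1 ∈ W ∧ p.2 ∈ W ∧ ∀ v v' : Pattern A, v.AppearsIn p.1 → v'.AppearsIn p.2 →
    ∃ z ∈ W, v.AppearsIn z ∧ v'.AppearsIn z}

/-- The successor step of the hierarchy `T`. -/
def transitivityStep {A : Type u} [TopologicalSpace A]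
    (R : Set (Config A × Config A)) : Set (Config A × Config A) :=
  open Classical in if IsClosed R then transClosure R else closure R

/-- The relations `T_α` on `W`, for `1 ≤ α`. -/
def T {A : Type u} [TopologicalSpace A] (W : Set (Config A)) (α : Ordinal.{0}) :
    Set (Config A × Config A) :=
  levels (transitivityPairs W) transitivityStep α

/-- `W` is generalized transitive: `T_α = W²` for some `α ∈ [1, ω₁)`. -/
def IsGeneralizedTransitive {A : Type u} [TopologicalSpace A] (W : Set (Config A)) : Prop :=
  ∃ α : Ordinal.{0}, 1 ≤ α ∧ α < Ordinal.omega 1 ∧ T W α = W ×ˢ W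

/-- The generalized transitivity rank of `W`: the least `α ∈ [1, ω₁)` with `T_α = W²`
(`0` if there is none). -/
def transitivityRank {A : Type u} [TopologicalSpace A] (W : Set (Config A)) : Ordinal.{0} :=
  sInf {α | 1 ≤ α ∧ α < Ordinal.omega 1 ∧ T W α = W ×ˢ W}

/-! ### Printing a configuration on fabric -/

/-- A family of ribbons. Read horizontally, the `i`-th ribbon is the set of sites `(n, R i n)`.
Ribbons are paths that make steps of height `-1`, `0` or `1`, never twice in a row in the same
direction up or down, and consecutive ribbons are at distance `2`, `3` or `4` everywhere; so the
perfectly straight family `R i n = 3 * i` can be wiggled freely. -/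
structure IsRibbonFamily (R : ℤ → ℤ → ℤ) : Prop where
  step_one : ∀ i n, |R i (n + 1) - R i n| ≤ 1
  step_two : ∀ i n, |R i (n + 2) - R i n| ≤ 1
  two_le_gap : ∀ i n, 2 ≤ R (i + 1) n - R i n
  gap_le_four : ∀ i n, R (i + 1) n - R i n ≤ 4

/-- The alphabet of the fabric. The first coordinate of a symbol tells whether a horizontal ribbon
passes through the site, and its direction there; the second coordinate does the same for vertical
ribbons; the third coordinate holds a letter of `A` at the crossings of the ribbons. -/
def Symbol (A : Type u) : Type u := Option SignType × Option SignType × Option A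

instance (A : Type u) : TopologicalSpace (Symbol A) := ⊥

instance (A : Type u) : DiscreteTopology (Symbol A) := ⟨rfl⟩

instance (A : Type u) [Finite A] : Finite (Symbol A) :=
  inferInstanceAs (Finite (Option SignType × Option SignType × Option A))

/-- The horizontal ribbon `i` (through the sites `(n, H i n)`) crosses the vertical ribbon `j`
(through the sites `(V j m, m)`) at the column `n`: the site `(n, H i n)` is the last one of the
horizontal ribbon that does not lie to the right of the vertical ribbon. Since ribbons climb at
most one step in two, every horizontal ribbon crosses every vertical one exactly once. -/
def CrossesAt (H V : ℤ → ℤ → ℤ) (i j n : ℤ) : Prop :=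
  n ≤ V j (H i n) ∧ V j (H i (n + 1)) < n + 1

/-- `y` is the configuration `x` printed on the fabric with horizontal ribbons `H` and vertical
ribbons `V`: the ribbons and their directions are recorded in the first two coordinates of `y`,
and the letter `x (j, i)` is written where the horizontal ribbon `i` crosses the vertical
ribbon `j`. -/
structure IsWeave {A : Type u} (H V : ℤ → ℤ → ℤ) (x : Config A) (y : Config (Symbol A)) :
    Prop where
  horizontal : ∀ (n m : ℤ) (d : SignType),
    (y (n, m)).1 = some d ↔ ∃ i, m = H i n ∧ (d : ℤ) = H i (n + 1) - H i n
  vertical : ∀ (n m : ℤ) (d : SignType),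
    (y (n, m)).2.1 = some d ↔ ∃ j, n = V j m ∧ (d : ℤ) = V j (m + 1) - V j m
  letter : ∀ (n m : ℤ) (a : A),
    (y (n, m)).2.2 = some a ↔ ∃ i j, m = H i n ∧ CrossesAt H V i j n ∧ a = x (j, i)

/-- The fabric map: `f(x)` is the set of all the ways to print `x` on fabric. -/
def fabric {A : Type u} (x : Config A) : Set (Config (Symbol A)) :=
  {y | ∃ H V : ℤ → ℤ → ℤ, IsRibbonFamily H ∧ IsRibbonFamily V ∧ IsWeave H V x y}

/-- `f(W)`, the union of the sets `f(x)` for `x ∈ W`. -/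
def fabricSet {A : Type u} (W : Set (Config A)) : Set (Config (Symbol A)) :=
  ⋃ x ∈ W, fabric x

/-- `f(R)`, the union of the sets `f(x) × f(x')` for `(x, x') ∈ R`. -/
def fabricRel {A : Type u} (R : Set (Config A × Config A)) :
    Set (Config (Symbol A) × Config (Symbol A)) :=
  ⋃ p ∈ R, fabric p.1 ×ˢ fabric p.2

end Fabric

end

/-!
A point `y ∈ f(x)` determines `x` up to a shift, and every relation `T_α` is invariant under
independent shifts of its two points, so `T_α` can be recovered from `f(T_α)`. The map `f` on such
relations commutes with unions, with transitive closures and, since normalized ribbon families form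
a compact space, with closures. Hence `f(T_α) = E_α` for all `α` as soon as `f(T₁) = E₁`.

* If a pattern `v` of `x` and a pattern `v'` of `x'` never occur in a common point of `W`, then no
  orbit of `f(W)` visits both a neighbourhood of `y ∈ f(x)` and one of `y' ∈ f(x')`, so the cover
  by their complements has zero entropy.
* The displacement of a ribbon family from the straight family `3i` is Lipschitz, hence can be
  clamped to zero outside a bounded region. Central pieces of the weaves of `y` and `y'` can
  therefore be placed independently at any sparse set of sites. If `(x, x')` is a transitivity
  pair, the fully supported measure yields a point of `W` showing large pieces of both `x` and `x'`
  around a positive density of sites, and weaving `y` or `y'` there at will gives positive entropy.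

If `E_α` is everything, the kernel of a factor without entropy is a closed equivalence relation
containing `E₁`, hence everything. Conversely, the first `T_α` that is both closed and transitive
gives a closed equivalence relation `f(T_α)` which contains the shift orbits, so `ℤ²` acts trivially
on the quotient; a trivial action has zero entropy, and TCPE makes the quotient a point.
-/

namespace Fabric

universe u

/-! ### Ribbon families -/

theorem abs_sub_le_zsmul {G : Type*} [AddCommGroup G] [LinearOrder G] [IsOrderedAddMonoid G]
    {f : ℤ → G} {c : G} (hf : ∀ n, |f (n + 1) - f n| ≤ c) (n m : ℤ) :
    |f n - f m| ≤ |n - m| • c := by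
  wlog h : m ≤ n generalizing n m
  · rw [abs_sub_comm, abs_sub_comm n m]
    exact this m n (by omega)
  induction n, h using Int.leInduction with
  | base => simp
  | succ n hn ih =>
    calc |f (n + 1) - f m| ≤ |f (n + 1) - f n| + |f n - f m| := abs_sub_le _ _ _
      _ ≤ c + |n - m| • c := add_le_add (hf n) ih
      _ = |n + 1 - m| • c := by
        rw [abs_of_nonneg (show 0 ≤ n - m by omega), abs_of_nonneg (show 0 ≤ n + 1 - m by omega),
          ← one_add_zsmul]
        ring_nf

theorem exists_and_not_succ {P : ℤ → Prop} {b : ℤ} (hb : ∀ n, P n → n ≤ b) (hP : ∃ n, P n) :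
    ∃ n, P n ∧ ¬ P (n + 1) := by
  obtain ⟨n, hn, hmax⟩ := Int.exists_greatest_of_bdd ⟨b, hb⟩ hP
  exact ⟨n, hn, fun h => by have := hmax _ h; omega⟩

/-- A displacement of the straight ribbon family: the conditions on `d` for `3 * i + d i n` to be a
ribbon family. They say that `d` is Lipschitz, and so are stable under truncation and gluing. -/
structure IsDisplacement (d : ℤ → ℤ → ℤ) : Prop where
  step_one : ∀ i n, |d i (n + 1) - d i n| ≤ 1
  step_two : ∀ i n, |d i (n + 2) - d i n| ≤ 1
  step_index : ∀ i n, |d (i + 1) n - d i n| ≤ 1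

section Ribbons

variable {R H V d : ℤ → ℤ → ℤ} {i j n m : ℤ}

theorem IsRibbonFamily.isDisplacement (hR : IsRibbonFamily R) :
    IsDisplacement fun i n => R i n - 3 * i where
  step_one i n := by simpa using hR.step_one i n
  step_two i n := by simpa using hR.step_two i n
  step_index i n := by
    have := hR.two_le_gap i n
    have := hR.gap_le_four i n
    rw [abs_le]
    omega

theorem IsDisplacement.isRibbonFamily (hd : IsDisplacement d) :
    IsRibbonFamily fun i n => 3 * i + d i n where
  step_one i n := by simpa using hd.step_one i n
  step_two i n := by simpa using hd.step_two i n
  two_le_gap i n := by have := abs_le.1 (hd.step_index i n); omega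
  gap_le_four i n := by have := abs_le.1 (hd.step_index i n); omega

theorem isDisplacement_zero : IsDisplacement 0 := by constructor <;> simp

theorem IsDisplacement.abs_sub_le_index (hd : IsDisplacement d) (i j n : ℤ) :
    |d i n - d j n| ≤ |i - j| := by
  simpa using abs_sub_le_zsmul (f := (d · n)) (hd.step_index · n) i j

theorem IsRibbonFamily.abs_sub_le_abs_sub (hR : IsRibbonFamily R) (i n m : ℤ) :
    |R i n - R i m| ≤ |n - m| := by
  simpa using abs_sub_le_zsmul (f := R i) (hR.step_one i) n m

theorem IsRibbonFamily.two_mul_abs_sub_le (hR : IsRibbonFamily R) (i n m : ℤ) :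
    2 * |R i n - R i m| ≤ |n - m| + 1 := by
  wlog h : m ≤ n generalizing n m
  · rw [abs_sub_comm, abs_sub_comm n m]
    exact this m n (by omega)
  have even (q : ℤ) : |R i (m + 2 * q) - R i m| ≤ |q| := by
    simpa [smul_eq_mul] using abs_sub_le_zsmul (f := fun q => R i (m + 2 * q)) (c := 1)
      (fun q => by simpa only [mul_add, mul_one, add_assoc] using hR.step_two i (m + 2 * q))
      q 0
  obtain ⟨q, rfl | rfl⟩ : ∃ q, n = m + 2 * q ∨ n = m + 2 * q + 1 :=
    ⟨(n - m) / 2, by omega⟩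
  · have := even q
    grind
  · have := even q
    have := hR.step_one i (m + 2 * q)
    grind

theorem IsRibbonFamily.abs_sub_three_mul_le (hR : IsRibbonFamily R) (i n : ℤ) :
    |R i n - 3 * i| ≤ |i| + |n| + |R 0 0| := by
  have h1 := hR.isDisplacement.abs_sub_le_index i 0 n
  have h2 := hR.abs_sub_le_abs_sub 0 n 0
  simp only [sub_zero, mul_zero] at h1 h2
  grind

theorem IsRibbonFamily.two_mul_abs_index_le (hR : IsRibbonFamily R) (i n : ℤ) :
    2 * |i| ≤ |R i n| + |n| + |R 0 0| := by
  have := hR.abs_sub_three_mul_le i n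
  grind

theorem IsRibbonFamily.strictMono (hR : IsRibbonFamily R) (n : ℤ) : StrictMono fun i => R i n :=
  strictMono_int_of_lt_succ fun i => by have := hR.two_le_gap i n; omega

theorem IsRibbonFamily.translate (hR : IsRibbonFamily R) (k g c : ℤ) :
    IsRibbonFamily fun i n => R (i + k) (n + g) - c where
  step_one i n := by simpa [add_right_comm n _ g] using hR.step_one (i + k) (n + g)
  step_two i n := by simpa [add_right_comm n _ g] using hR.step_two (i + k) (n + g)
  two_le_gap i n := by
    simpa [add_right_comm i _ k] using hR.two_le_gap (i + k) (n + g)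
  gap_le_four i n := by
    simpa [add_right_comm i _ k] using hR.gap_le_four (i + k) (n + g)

theorem IsRibbonFamily.exists_index (hR : IsRibbonFamily R) : ∃ k, R k 0 ∈ Icc (-4 : ℤ) 0 := by
  have near (i : ℤ) : |R i 0 - 3 * i| ≤ |i| + |R 0 0| := by
    simpa using hR.abs_sub_three_mul_le i 0
  obtain ⟨k, hk, hk'⟩ := exists_and_not_succ (P := fun i => R i 0 ≤ 0) (b := |R 0 0|)
    (fun i hi => by
      have := abs_le.1 (near i)
      have := abs_cases i
      have := abs_nonneg (R 0 0)
      omega)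
    ⟨-|R 0 0|, by have := abs_le.1 (near (-|R 0 0|)); rw [abs_neg, abs_abs] at this; omega⟩
  exact ⟨k, by have := hR.gap_le_four k 0; omega, hk⟩

theorem IsRibbonFamily.two_mul_abs_comp_sub_le (hV : IsRibbonFamily V) (hH : IsRibbonFamily H)
    (i j n m : ℤ) : 2 * |V j (H i n) - V j (H i m)| ≤ |n - m| + 1 := by
  have h1 := hV.abs_sub_le_abs_sub j (H i n) (H i m)
  have h2 := hH.two_mul_abs_sub_le i n m
  omega

theorem exists_crossesAt (hH : IsRibbonFamily H) (hV : IsRibbonFamily V) (i j : ℤ) :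
    ∃ n, CrossesAt H V i j n := by
  obtain ⟨n, hn, hn'⟩ := exists_and_not_succ (P := fun n => n ≤ V j (H i n))
    (b := 2 * |V j (H i 0)| + 1)
    (fun n hn => by have := hV.two_mul_abs_comp_sub_le hH i j n 0; grind)
    ⟨-(2 * |V j (H i 0)| + 1), by
      have := hV.two_mul_abs_comp_sub_le hH i j (-(2 * |V j (H i 0)| + 1)) 0; grind⟩
  exact ⟨n, hn, not_le.1 hn'⟩

theorem CrossesAt.mem_Icc (h : CrossesAt H V i j n) (hH : IsRibbonFamily H)
    (hV : IsRibbonFamily V) : V j (H i n) ∈ Icc n (n + 1) := by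
  have h1 := hH.step_one i n
  have h2 := hV.abs_sub_le_abs_sub j (H i (n + 1)) (H i n)
  have h3 := h.2
  exact ⟨h.1, by grind⟩

theorem CrossesAt.index_unique {j' : ℤ} (h : CrossesAt H V i j n) (h' : CrossesAt H V i j' n)
    (hH : IsRibbonFamily H) (hV : IsRibbonFamily V) : j = j' := by
  wlog hlt : j < j' generalizing j j'
  · by_contra hne
    exact hne (this h' h (by omega)).symm
  have h1 := (h.mem_Icc hH hV).1
  have h2 := (h'.mem_Icc hH hV).2
  have h3 := (hV.strictMono (H i n)).monotone (show j + 1 ≤ j' by omega)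
  have h4 := hV.two_le_gap j (H i n)
  omega

theorem exists_signType_eq {a : ℤ} (ha : |a| ≤ 1) : ∃ s : SignType, (s : ℤ) = a := by
  obtain rfl | rfl | rfl : a = -1 ∨ a = 0 ∨ a = 1 := by rw [abs_le] at ha; omega
  exacts [⟨-1, rfl⟩, ⟨0, rfl⟩, ⟨1, rfl⟩]

theorem signType_intCast_injective : Function.Injective ((↑) : SignType → ℤ) := by decide

end Ribbons

/-! ### Weaves -/

section Weaves

variable {A : Type u} {H V H' V' R R' : ℤ → ℤ → ℤ} {x x' : Config A} {y y' : Config (Symbol A)}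

theorem exists_option_eq_some_iff {α : Type*} {P : α → Prop} (hP : ∀ a b, P a → P b → a = b) :
    ∃ o : Option α, ∀ a, o = some a ↔ P a := by
  by_cases h : ∃ a, P a
  · obtain ⟨a, ha⟩ := h
    exact ⟨some a, fun b => ⟨fun hb => Option.some.inj hb ▸ ha, fun hb => by rw [hP a b ha hb]⟩⟩
  · exact ⟨none, fun b => ⟨fun hb => by simp at hb, fun hb => (h ⟨b, hb⟩).elim⟩⟩

theorem IsRibbonFamily.exists_direction (hR : IsRibbonFamily R) (n m : ℤ) :
    ∃ o : Option SignType, ∀ d : SignType,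
      o = some d ↔ ∃ i, m = R i n ∧ (d : ℤ) = R i (n + 1) - R i n := by
  refine exists_option_eq_some_iff ?_
  rintro a b ⟨i, hi, ha⟩ ⟨i', hi', hb⟩
  obtain rfl : i = i' := (hR.strictMono n).injective (hi.symm.trans hi')
  exact signType_intCast_injective (ha.trans hb.symm)

theorem exists_letter (hH : IsRibbonFamily H) (hV : IsRibbonFamily V) (x : Config A) (n m : ℤ) :
    ∃ o : Option A, ∀ a,
      o = some a ↔ ∃ i j, m = H i n ∧ CrossesAt H V i j n ∧ a = x (j, i) := by
  refine exists_option_eq_some_iff ?_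
  rintro a b ⟨i, j, hi, hc, ha⟩ ⟨i', j', hi', hc', hb⟩
  obtain rfl : i = i' := (hH.strictMono n).injective (hi.symm.trans hi')
  obtain rfl := hc.index_unique hc' hH hV
  exact ha.trans hb.symm

theorem exists_isWeave (hH : IsRibbonFamily H) (hV : IsRibbonFamily V) (x : Config A) :
    ∃ y, IsWeave H V x y := by
  choose o₁ h₁ using hH.exists_direction
  choose o₂ h₂ using hV.exists_direction
  choose o₃ h₃ using exists_letter hH hV x
  exact ⟨fun p => (o₁ p.1 p.2, o₂ p.2 p.1, o₃ p.1 p.2), fun n m => h₁ n m, fun n m => h₂ m n, h₃⟩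

theorem fabric_nonempty (x : Config A) : (fabric x).Nonempty := by
  obtain ⟨y, hy⟩ :=
    exists_isWeave isDisplacement_zero.isRibbonFamily isDisplacement_zero.isRibbonFamily x
  exact ⟨y, _, _, isDisplacement_zero.isRibbonFamily, isDisplacement_zero.isRibbonFamily, hy⟩

theorem IsWeave.translate (h : IsWeave H V x y) (g k : ℤ × ℤ) :
    IsWeave (fun i n => H (i + k.2) (n + g.1) - g.2) (fun j m => V (j + k.1) (m + g.2) - g.1)
      (fun p => x (p + k)) (fun p => y (p + g)) where
  horizontal n m d := by
    rw [show (n, m) + g = (n + g.1, m + g.2) from rfl, h.horizontal]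
    refine ((Equiv.addRight k.2).exists_congr fun i => ?_).symm
    simp only [Equiv.coe_addRight, add_right_comm n 1]
    omega
  vertical n m d := by
    rw [show (n, m) + g = (n + g.1, m + g.2) from rfl, h.vertical]
    refine ((Equiv.addRight k.1).exists_congr fun j => ?_).symm
    simp only [Equiv.coe_addRight, add_right_comm m 1]
    omega
  letter n m a := by
    rw [show (n, m) + g = (n + g.1, m + g.2) from rfl, h.letter]
    refine ((Equiv.addRight k.2).exists_congr fun i =>
      (Equiv.addRight k.1).exists_congr fun j => ?_).symm
    simp only [Equiv.coe_addRight, add_right_comm n 1, CrossesAt, sub_add_cancel, Prod.add_def]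
    grind

/-! ### The configuration printed on a fabric is determined up to a shift -/

theorem exists_add_of_range_eq {a b : ℤ → ℤ} (ha : StrictMono a) (hb : StrictMono b)
    (h : range a = range b) : ∃ k, ∀ i, b i = a (i + k) := by
  let φ : ℤ ≃o ℤ :=
    (hb.orderIso b).trans ((OrderIso.setCongr _ _ h.symm).trans (ha.orderIso a).symm)
  have hφ (i : ℤ) : a (φ i) = b i :=
    congrArg Subtype.val ((ha.orderIso a).apply_symm_apply ⟨b i, h ▸ mem_range_self i⟩)
  have periodic : Function.Periodic (fun i => φ i - i) 1 := fun i => by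
    have : φ (i + 1) = φ i + 1 := φ.map_succ i
    simp only [this, add_sub_add_right_eq_sub]
  refine ⟨φ 0, fun i => ?_⟩
  have : φ i - i = φ 0 - 0 := by simpa using periodic.int_mul_eq i
  rw [← hφ, ← sub_zero (φ 0), ← this, add_sub_cancel]

theorem IsRibbonFamily.exists_eq_add (hR : IsRibbonFamily R) (hR' : IsRibbonFamily R')
    (h : ∀ (n m : ℤ) (d : SignType), (∃ i, m = R i n ∧ (d : ℤ) = R i (n + 1) - R i n) ↔
      ∃ i, m = R' i n ∧ (d : ℤ) = R' i (n + 1) - R' i n) :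
    ∃ k, ∀ i n, R' i n = R (i + k) n := by
  have exists_same (i n : ℤ) : ∃ i', R' i n = R i' n ∧ R' i (n + 1) = R i' (n + 1) := by
    obtain ⟨d, hd⟩ := exists_signType_eq (hR'.step_one i n)
    obtain ⟨i', hi', hd'⟩ := (h n (R' i n) d).2 ⟨i, rfl, hd⟩
    exact ⟨i', hi', by omega⟩
  have exists_same' (i n : ℤ) : ∃ i', R' i' n = R i n := by
    obtain ⟨d, hd⟩ := exists_signType_eq (hR.step_one i n)
    obtain ⟨i', hi', -⟩ := (h n (R i n) d).1 ⟨i, rfl, hd⟩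
    exact ⟨i', hi'.symm⟩
  have exists_offset (n : ℤ) : ∃ k, ∀ i, R' i n = R (i + k) n := by
    refine exists_add_of_range_eq (hR.strictMono n) (hR'.strictMono n) (Subset.antisymm ?_ ?_)
    · rintro _ ⟨i, rfl⟩
      exact exists_same' i n
    · rintro _ ⟨i, rfl⟩
      obtain ⟨i', hi', -⟩ := exists_same i n
      exact ⟨i', hi'.symm⟩
  choose k hk using exists_offset
  have periodic : Function.Periodic k 1 := fun n => by
    obtain ⟨i, hi, hi'⟩ := exists_same 0 n
    have h1 : 0 + k n = i := (hR.strictMono n).injective ((hk n 0).symm.trans hi)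
    have h2 : 0 + k (n + 1) = i :=
      (hR.strictMono (n + 1)).injective ((hk (n + 1) 0).symm.trans hi')
    omega
  refine ⟨k 0, fun i n => ?_⟩
  rw [hk n, show k n = k 0 by simpa using periodic.int_mul_eq n]

theorem IsWeave.exists_translate_eq (h : IsWeave H V x y) (h' : IsWeave H' V' x' y)
    (hH : IsRibbonFamily H) (hV : IsRibbonFamily V) (hH' : IsRibbonFamily H')
    (hV' : IsRibbonFamily V') : ∃ k : ℤ × ℤ, ∀ p, x' p = x (p + k) := by
  obtain ⟨k₂, hk₂⟩ := hH.exists_eq_add hH' fun n m d => by rw [← h.horizontal, h'.horizontal]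
  obtain ⟨k₁, hk₁⟩ := hV.exists_eq_add hV' fun m n d => by rw [← h.vertical, h'.vertical]
  refine ⟨(k₁, k₂), fun ⟨j, i⟩ => ?_⟩
  obtain ⟨n, hn⟩ := exists_crossesAt hH' hV' i j
  obtain ⟨i₂, j₂, hi, hc, hx⟩ := (h.letter n _ _).1 ((h'.letter n _ _).2 ⟨i, j, rfl, hn, rfl⟩)
  obtain rfl : i + k₂ = i₂ := (hH.strictMono n).injective ((hk₂ i n).symm.trans hi)
  have hc' : CrossesAt H V (i + k₂) (j + k₁) n := by simpa only [CrossesAt, hk₁, hk₂] using hn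
  rw [hx, hc.index_unique hc' hH hV]
  rfl

/-! ### A weave depends locally on its ribbons and letters -/

/-- The sites of `ℤ²` within sup-distance `N` of the origin. -/
noncomputable def box (N : ℤ) : Finset (ℤ × ℤ) := Finset.Icc (-N) N ×ˢ Finset.Icc (-N) N

theorem mem_box {N : ℤ} {p : ℤ × ℤ} : p ∈ box N ↔ |p.1| ≤ N ∧ |p.2| ≤ N := by
  simp only [box, Finset.mem_product, Finset.mem_Icc, abs_le]

theorem box_subset_box {M N : ℤ} (h : M ≤ N) : box M ⊆ box N := fun _ hp =>
  mem_box.2 ⟨(mem_box.1 hp).1.trans h, (mem_box.1 hp).2.trans h⟩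

theorem IsRibbonFamily.eq_of_eqOn_box (hR : IsRibbonFamily R) {I i n m : ℤ}
    (h : EqOn R.uncurry R'.uncurry (box I)) (hn : |R i n| + |n| + |R 0 0| ≤ 2 * I)
    (hm : |m| ≤ I) : R i m = R' i m := by
  have := hR.two_mul_abs_index_le i n
  exact h (x := (i, m)) (mem_box.2 ⟨by simp only; omega, hm⟩)

section Agree

variable {N I : ℤ} (h : IsWeave H V x y) (h' : IsWeave H' V' x' y') {p : ℤ × ℤ} (hp : p ∈ box N)

include h h' hp

theorem IsWeave.horizontal_eq_some_of_eqOn (hH : IsRibbonFamily H) (hI : N + |H 0 0| + 1 ≤ I)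
    (hHH : EqOn H.uncurry H'.uncurry (box I)) {d : SignType} (hd : (y p).1 = some d) :
    (y' p).1 = some d := by
  obtain ⟨n, m⟩ := p
  obtain ⟨hn, hm⟩ := mem_box.1 hp
  obtain ⟨i, rfl, hdir⟩ := (h.horizontal _ _ _).1 hd
  have same (l : ℤ) (hl : |l| ≤ I) : H i l = H' i l :=
    hH.eq_of_eqOn_box hHH (n := n) (by grind) hl
  exact (h'.horizontal _ _ _).2
    ⟨i, same n (by grind), by rw [hdir, same n (by grind), same (n + 1) (by grind)]⟩

theorem IsWeave.vertical_eq_some_of_eqOn (hV : IsRibbonFamily V) (hI : N + |V 0 0| + 1 ≤ I)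
    (hVV : EqOn V.uncurry V'.uncurry (box I)) {d : SignType} (hd : (y p).2.1 = some d) :
    (y' p).2.1 = some d := by
  obtain ⟨n, m⟩ := p
  obtain ⟨hn, hm⟩ := mem_box.1 hp
  obtain ⟨j, rfl, hdir⟩ := (h.vertical _ _ _).1 hd
  have same (l : ℤ) (hl : |l| ≤ I) : V j l = V' j l :=
    hV.eq_of_eqOn_box hVV (n := m) (by grind) hl
  exact (h'.vertical _ _ _).2
    ⟨j, same m (by grind), by rw [hdir, same m (by grind), same (m + 1) (by grind)]⟩

theorem IsWeave.letter_eq_some_of_eqOn (hH : IsRibbonFamily H) (hV : IsRibbonFamily V)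
    (hI : N + |H 0 0| + |V 0 0| + 1 ≤ I) (hHH : EqOn H.uncurry H'.uncurry (box I))
    (hVV : EqOn V.uncurry V'.uncurry (box I)) (hxx : EqOn x x' (box I)) {a : A}
    (ha : (y p).2.2 = some a) : (y' p).2.2 = some a := by
  obtain ⟨n, m⟩ := p
  obtain ⟨hn, hm⟩ := mem_box.1 hp
  obtain ⟨i, j, rfl, hc, rfl⟩ := (h.letter _ _ _).1 ha
  obtain ⟨hcross, hcross'⟩ := hc.mem_Icc hH hV
  have hstep := hH.step_one i n
  have hn1 : |n + 1| ≤ N + 1 := by grind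
  have hcol : |V j (H i n)| ≤ N + 1 := by grind
  have hrow : |H i (n + 1)| ≤ N + 1 := by grind
  have hi := hH.two_mul_abs_index_le i n
  have hj := hV.two_mul_abs_index_le j (H i n)
  have hH0 := abs_nonneg (H 0 0)
  have hV0 := abs_nonneg (V 0 0)
  simp only at hn hm
  have sameH (l : ℤ) (hl : |l| ≤ N + 1) : H i l = H' i l :=
    hH.eq_of_eqOn_box hHH (n := n) (by omega) (by omega)
  have sameV (l : ℤ) (hl : |l| ≤ N + 1) : V j l = V' j l :=
    hV.eq_of_eqOn_box hVV (n := H i n) (by omega) (by omega)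
  refine (h'.letter _ _ _).2
    ⟨i, j, sameH n (by omega), ?_, hxx (mem_box.2 ⟨by simp only; omega, by simp only; omega⟩)⟩
  rwa [CrossesAt, ← sameH n (by omega), ← sameH _ hn1, ← sameV _ (by omega), ← sameV _ hrow]

theorem IsWeave.eq_of_eqOn (hH : IsRibbonFamily H) (hV : IsRibbonFamily V)
    (hH' : IsRibbonFamily H') (hV' : IsRibbonFamily V') (hI : N + |H 0 0| + |V 0 0| + 1 ≤ I)
    (hHH : EqOn H.uncurry H'.uncurry (box I)) (hVV : EqOn V.uncurry V'.uncurry (box I))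
    (hxx : EqOn x x' (box I)) : y p = y' p := by
  have hN := (abs_nonneg _).trans (mem_box.1 hp).1
  have hH0 := abs_nonneg (H 0 0)
  have hV0 := abs_nonneg (V 0 0)
  have origin : (0, 0) ∈ box I := by
    simp only [mem_box, abs_zero, and_self]
    omega
  have eqH : H 0 0 = H' 0 0 := hHH origin
  have eqV : V 0 0 = V' 0 0 := hVV origin
  refine Prod.ext (Option.ext fun d => ⟨?_, ?_⟩)
    (Prod.ext (Option.ext fun d => ⟨?_, ?_⟩) (Option.ext fun a => ⟨?_, ?_⟩))
  · exact h.horizontal_eq_some_of_eqOn h' hp hH (by omega) hHH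
  · exact h'.horizontal_eq_some_of_eqOn h hp hH' (by rw [← eqH]; omega) hHH.symm
  · exact h.vertical_eq_some_of_eqOn h' hp hV (by omega) hVV
  · exact h'.vertical_eq_some_of_eqOn h hp hV' (by rw [← eqV]; omega) hVV.symm
  · exact h.letter_eq_some_of_eqOn h' hp hH hV hI hHH hVV hxx
  · exact h'.letter_eq_some_of_eqOn h hp hH' hV' (by rwa [← eqH, ← eqV]) hHH.symm hVV.symm hxx.symm

end Agree

end Weaves

/-! ### Shifts and the fabric map -/

section Shifts

variable {A : Type u} {x x' : Config A} {y : Config (Symbol A)} {R S : Set (Config A × Config A)}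

theorem shift_zero (x : Config A) : shift 0 x = x := by
  funext h
  simp only [shift, sub_zero]

theorem continuous_shift [TopologicalSpace A] (g : ℤ × ℤ) : Continuous (shift (A := A) g) :=
  continuous_pi fun _ => continuous_apply _

theorem shift_mem_fabric (g : ℤ × ℤ) (hy : y ∈ fabric x) : shift g y ∈ fabric x := by
  obtain ⟨H, V, hH, hV, h⟩ := hy
  refine ⟨_, _, hH.translate 0 (-g.1) (-g.2), hV.translate 0 (-g.2) (-g.1), ?_⟩
  unfold shift
  simpa [sub_eq_add_neg] using h.translate (-g) 0

theorem exists_eq_shift_of_mem_fabric (hy : y ∈ fabric x) (hy' : y ∈ fabric x') :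
    ∃ k, x' = shift k x := by
  obtain ⟨H, V, hH, hV, h⟩ := hy
  obtain ⟨H', V', hH', hV', h'⟩ := hy'
  obtain ⟨k, hk⟩ := h.exists_translate_eq h' hH hV hH' hV'
  exact ⟨-k, funext fun p => by simpa only [shift, sub_neg_eq_add] using hk p⟩

theorem mem_fabricSet {W : Set (Config A)} : y ∈ fabricSet W ↔ ∃ x ∈ W, y ∈ fabric x := by
  simp only [fabricSet, mem_iUnion, exists_prop]

theorem mem_fabricRel {p : Config (Symbol A) × Config (Symbol A)} :
    p ∈ fabricRel R ↔ ∃ q ∈ R, p.1 ∈ fabric q.1 ∧ p.2 ∈ fabric q.2 := by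
  simp only [fabricRel, mem_iUnion, mem_prod, exists_prop]

theorem fabricRel_mono (h : R ⊆ S) : fabricRel R ⊆ fabricRel S :=
  biUnion_subset_biUnion_left h

theorem fabricRel_prod (W : Set (Config A)) :
    fabricRel (W ×ˢ W) = fabricSet W ×ˢ fabricSet W := by
  ext p
  simp only [mem_fabricRel, mem_prod, mem_fabricSet, Prod.exists]
  constructor
  · rintro ⟨a, b, ⟨ha, hb⟩, h1, h2⟩
    exact ⟨⟨a, ha, h1⟩, b, hb, h2⟩
  · rintro ⟨⟨a, ha, h1⟩, b, hb, h2⟩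
    exact ⟨a, b, ⟨ha, hb⟩, h1, h2⟩

/-- Invariance of a relation between configurations under independent shifts of the two sides.
By `exists_eq_shift_of_mem_fabric`, such relations can be read off from their fabric images. -/
def IsBishiftInvariant (R : Set (Config A × Config A)) : Prop :=
  ∀ g h, ∀ p ∈ R, (shift g p.1, shift h p.2) ∈ R

theorem IsBishiftInvariant.mem_of_mem_fabricRel (hR : IsBishiftInvariant R)
    {y y' : Config (Symbol A)} (h : (y, y') ∈ fabricRel R) (hy : y ∈ fabric x)
    (hy' : y' ∈ fabric x') : (x, x') ∈ R := by
  obtain ⟨⟨z, z'⟩, hz, hyz, hyz'⟩ := mem_fabricRel.1 h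
  obtain ⟨k, rfl⟩ := exists_eq_shift_of_mem_fabric hyz hy
  obtain ⟨k', rfl⟩ := exists_eq_shift_of_mem_fabric hyz' hy'
  exact hR k k' _ hz

theorem IsBishiftInvariant.closure [TopologicalSpace A] (hR : IsBishiftInvariant R) :
    IsBishiftInvariant (closure R) := fun g h _ hp =>
  map_mem_closure (f := Prod.map (shift g) (shift h))
    ((continuous_shift g).prodMap (continuous_shift h)) hp (hR g h)

theorem IsSubshift.isBishiftInvariant_prod [TopologicalSpace A] {W : Set (Config A)}
    (hW : IsSubshift W) : IsBishiftInvariant (W ×ˢ W) :=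
  fun g h _ hp => ⟨hW.shift_mem g _ hp.1, hW.shift_mem h _ hp.2⟩

end Shifts

/-! ### Compactness of the space of weaves -/

section Compactness

variable {A : Type u} {H V : ℤ → ℤ → ℤ} {x : Config A} {y y' : Config (Symbol A)}

theorem mem_box_max (p : ℤ × ℤ) : p ∈ box (max |p.1| |p.2|) :=
  mem_box.2 ⟨le_max_left _ _, le_max_right _ _⟩

theorem eventually_eqOn_finset {X ι D : Type*} [TopologicalSpace X] [TopologicalSpace D]
    [DiscreteTopology D] {f : X → ι → D} (hf : ∀ i, Continuous fun p => f p i) (q : X)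
    (F : Finset ι) : ∀ᶠ p in 𝓝 q, EqOn (f p) (f q) F :=
  (Filter.eventually_all_finset F).2 fun i _ =>
    (hf i).continuousAt.eventually ((isOpen_discrete {f q i}).mem_nhds rfl)

theorem isClosed_setOf_isRibbonFamily : IsClosed {R : ℤ → ℤ → ℤ | IsRibbonFamily R} := by
  have isClosed_setOf_forall {P : ℤ → ℤ → (ℤ → ℤ → ℤ) → Prop}
      (hP : ∀ i n, IsClosed {R | P i n R}) : IsClosed {R | ∀ i n, P i n R} := by
    simp only [ofPred_forall]
    exact isClosed_iInter fun i => isClosed_iInter fun n => hP i n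
  have : {R : ℤ → ℤ → ℤ | IsRibbonFamily R} =
      {R | ∀ i n, |R i (n + 1) - R i n| ≤ 1} ∩ {R | ∀ i n, |R i (n + 2) - R i n| ≤ 1} ∩
        {R | ∀ i n, 2 ≤ R (i + 1) n - R i n} ∩ {R | ∀ i n, R (i + 1) n - R i n ≤ 4} := by
    ext R
    exact ⟨fun h => ⟨⟨⟨h.1, h.2⟩, h.3⟩, h.4⟩, fun h => ⟨h.1.1.1, h.1.1.2, h.1.2, h.2⟩⟩
  rw [this]
  refine ((IsClosed.inter ?_ ?_).inter ?_).inter ?_ <;>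
    exact isClosed_setOf_forall fun i n => isClosed_le (by fun_prop) (by fun_prop)

/-- Ribbon families whose ribbon number `0` passes close to the origin. Unlike the space of all
ribbon families, they form a compact space. -/
def normalizedRibbons : Set (ℤ → ℤ → ℤ) := {R | IsRibbonFamily R ∧ R 0 0 ∈ Icc (-4 : ℤ) 0}

theorem isCompact_normalizedRibbons : IsCompact normalizedRibbons := by
  have hK : IsCompact (univ.pi fun i : ℤ => univ.pi fun n : ℤ =>
      Icc (3 * i - (|i| + |n| + 4)) (3 * i + (|i| + |n| + 4))) :=
    isCompact_univ_pi fun i => isCompact_univ_pi fun n => (finite_Icc _ _).isCompact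
  refine hK.of_isClosed_subset (isClosed_setOf_isRibbonFamily.inter ?_) ?_
  · exact (isClosed_discrete (Icc (-4 : ℤ) 0)).preimage
      (show Continuous fun R : ℤ → ℤ → ℤ => R 0 0 by fun_prop)
  · rintro R ⟨hR, h0⟩ i - n -
    have := abs_le.1 (hR.abs_sub_three_mul_le i n)
    have : |R 0 0| ≤ 4 := abs_le.2 ⟨h0.1, h0.2.trans (by norm_num)⟩
    exact ⟨by omega, by omega⟩

/-- All the ways to print configurations on normalized ribbons: the space of quadruples
`(H, V, x, y)` for which `y` is `x` printed on the fabric with ribbons `H` and `V`. -/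
def weaves (A : Type u) :
    Set ((ℤ → ℤ → ℤ) × (ℤ → ℤ → ℤ) × Config A × Config (Symbol A)) :=
  {q | q.1 ∈ normalizedRibbons ∧ q.2.1 ∈ normalizedRibbons ∧ IsWeave q.1 q.2.1 q.2.2.1 q.2.2.2}

theorem mem_fabric_of_mem_weaves (h : (H, V, x, y) ∈ weaves A) : y ∈ fabric x :=
  ⟨H, V, h.1.1, h.2.1.1, h.2.2⟩

theorem exists_mem_weaves (hy : y ∈ fabric x) : ∃ k H V, (H, V, shift k x, y) ∈ weaves A := by
  obtain ⟨H, V, hH, hV, h⟩ := hy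
  obtain ⟨a, ha⟩ := hH.exists_index
  obtain ⟨b, hb⟩ := hV.exists_index
  refine ⟨(-b, -a), _, _, ⟨hH.translate a 0 0, by simpa using ha⟩,
    ⟨hV.translate b 0 0, by simpa using hb⟩, ?_⟩
  unfold shift
  simpa [sub_eq_add_neg] using h.translate 0 (b, a)

theorem IsWeave.unique (h : IsWeave H V x y) (h' : IsWeave H V x y') : y = y' := by
  funext ⟨n, m⟩
  exact Prod.ext (Option.ext fun d => (h.horizontal n m d).trans (h'.horizontal n m d).symm)
    (Prod.ext (Option.ext fun d => (h.vertical n m d).trans (h'.vertical n m d).symm)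
      (Option.ext fun a => (h.letter n m a).trans (h'.letter n m a).symm))

variable [TopologicalSpace A] [DiscreteTopology A]

theorem isClosed_weaves : IsClosed (weaves A) := by
  refine isClosed_of_closure_subset fun q hq => ?_
  have hN := isCompact_normalizedRibbons.isClosed
  have hH : q.1 ∈ normalizedRibbons :=
    closure_minimal (fun p hp => hp.1) (hN.preimage continuous_fst) hq
  have hV : q.2.1 ∈ normalizedRibbons :=
    closure_minimal (fun p hp => hp.2.1) (hN.preimage (continuous_fst.comp continuous_snd)) hq
  obtain ⟨y, hy⟩ := exists_isWeave hH.1 hV.1 q.2.2.1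
  suffices h : q.2.2.2 = y from ⟨hH, hV, h ▸ hy⟩
  funext p
  have eventuallyH := eventually_eqOn_finset (f := fun r : (ℤ → ℤ → ℤ) × (ℤ → ℤ → ℤ) × Config A ×
    Config (Symbol A) => r.1.uncurry) (fun i => by simp only [Function.uncurry]; fun_prop) q
  have eventuallyV := eventually_eqOn_finset (f := fun r : (ℤ → ℤ → ℤ) × (ℤ → ℤ → ℤ) × Config A ×
    Config (Symbol A) => r.2.1.uncurry) (fun i => by simp only [Function.uncurry]; fun_prop) q
  have eventuallyX := eventually_eqOn_finset (f := fun r : (ℤ → ℤ → ℤ) × (ℤ → ℤ → ℤ) × Config A ×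
    Config (Symbol A) => r.2.2.1) (fun i => by fun_prop) q
  have eventuallyY := eventually_eqOn_finset (f := fun r : (ℤ → ℤ → ℤ) × (ℤ → ℤ → ℤ) × Config A ×
    Config (Symbol A) => r.2.2.2) (fun i => by fun_prop) q {p}
  obtain ⟨r, hr, hrH, hrV, hrX, hrY⟩ := ((mem_closure_iff_frequently.1 hq).and_eventually
    ((eventuallyH _).and ((eventuallyV _).and ((eventuallyX _).and eventuallyY)))).exists
  rw [← hrY (Finset.mem_singleton_self p)]
  exact (hy.eq_of_eqOn hr.2.2 (mem_box_max p) hH.1 hV.1 hr.1.1 hr.2.1.1 le_rfl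
    hrH.symm hrV.symm hrX.symm).symm

theorem exists_continuous_isWeave (hH : IsRibbonFamily H) (hV : IsRibbonFamily V) :
    ∃ F : Config A → Config (Symbol A), Continuous F ∧ ∀ x, IsWeave H V x (F x) := by
  choose F hF using fun x : Config A => exists_isWeave hH hV x
  refine ⟨F, continuous_pi fun p => continuous_iff_continuousAt.2 fun x => ?_, hF⟩
  rw [ContinuousAt, nhds_discrete (Symbol A), tendsto_pure]
  have eventually_agree := eventually_eqOn_finset (f := fun x : Config A => x)
    (fun p => by fun_prop) x (box (max |p.1| |p.2| + |H 0 0| + |V 0 0| + 1))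
  exact eventually_agree.mono fun x' hx' => (hF x').eq_of_eqOn (hF x) (mem_box_max p)
    hH hV hH hV le_rfl (fun _ _ => rfl) (fun _ _ => rfl) hx'

theorem fabricRel_closure_subset (R : Set (Config A × Config A)) :
    fabricRel (closure R) ⊆ closure (fabricRel R) := by
  rintro ⟨y, y'⟩ h
  obtain ⟨⟨x, x'⟩, hx, ⟨H, V, hH, hV, hy⟩, ⟨H', V', hH', hV', hy'⟩⟩ := mem_fabricRel.1 h
  obtain ⟨F, hF, hFw⟩ := exists_continuous_isWeave (A := A) hH hV
  obtain ⟨F', hF', hFw'⟩ := exists_continuous_isWeave (A := A) hH' hV'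
  obtain rfl := hy.unique (hFw x)
  obtain rfl := hy'.unique (hFw' x')
  exact map_mem_closure (f := Prod.map F F') (hF.prodMap hF') hx fun p hp =>
    mem_fabricRel.2 ⟨p, hp, ⟨H, V, hH, hV, hFw p.1⟩, ⟨H', V', hH', hV', hFw' p.2⟩⟩

variable [Finite A] {R : Set (Config A × Config A)}

theorem isCompact_weaves : IsCompact (weaves A) :=
  (isCompact_normalizedRibbons.prod
    (isCompact_normalizedRibbons.prod isCompact_univ)).of_isClosed_subset isClosed_weaves
    fun _ hq => ⟨hq.1, hq.2.1, mem_univ _⟩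

theorem isClosed_fabricRel (hR : IsClosed R) (hinv : IsBishiftInvariant R) :
    IsClosed (fabricRel R) := by
  have h : fabricRel R = (fun q => (q.1.2.2.2, q.2.2.2.2)) ''
      ((weaves A ×ˢ weaves A) ∩ (fun q => (q.1.2.2.1, q.2.2.2.1)) ⁻¹' R) := by
    ext ⟨y, y'⟩
    rw [mem_fabricRel]
    constructor
    · rintro ⟨⟨x, x'⟩, hx, hy, hy'⟩
      obtain ⟨k, H, V, h⟩ := exists_mem_weaves hy
      obtain ⟨k', H', V', h'⟩ := exists_mem_weaves hy'
      exact ⟨(_, _), ⟨⟨h, h'⟩, hinv k k' _ hx⟩, rfl⟩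
    · rintro ⟨⟨⟨H, V, x, z⟩, ⟨H', V', x', z'⟩⟩, ⟨⟨h, h'⟩, hx⟩, he⟩
      obtain ⟨rfl, rfl⟩ := Prod.mk.inj he
      exact ⟨_, hx, mem_fabric_of_mem_weaves h, mem_fabric_of_mem_weaves h'⟩
  rw [h]
  exact (((isCompact_weaves.prod isCompact_weaves).inter_right
    (hR.preimage (by fun_prop))).image (by fun_prop)).isClosed

theorem fabricRel_closure (hinv : IsBishiftInvariant R) :
    fabricRel (closure R) = closure (fabricRel R) :=
  (fabricRel_closure_subset R).antisymm (closure_minimal (fabricRel_mono subset_closure)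
    (isClosed_fabricRel isClosed_closure hinv.closure))

theorem isSubshift_fabricSet {W : Set (Config A)} (hW : IsSubshift W) :
    IsSubshift (fabricSet W) where
  isClosed := by
    have isClosed_prod : IsClosed (fabricSet W ×ˢ fabricSet W) := by
      rw [← fabricRel_prod]
      exact isClosed_fabricRel (hW.isClosed.prod hW.isClosed) hW.isBishiftInvariant_prod
    simpa only [preimage, mem_prod, and_self, ofPred_mem_eq] using
      isClosed_prod.preimage (f := fun y => (y, y)) (by fun_prop)
  shift_mem g y hy := by
    obtain ⟨x, hx, hy⟩ := mem_fabricSet.1 hy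
    exact mem_fabricSet.2 ⟨x, hx, shift_mem_fabric g hy⟩

end Compactness

/-! ### Transfinite iteration -/

section Levels

variable {P P' : Type u} {base : Set P} {step : Set P → Set P} {base' : Set P'}
  {step' : Set P' → Set P'}

theorem levels_zero : levels base step 0 = base := by
  simp only [levels, Ordinal.limitRecOn_zero]

theorem levels_one : levels base step 1 = base := by
  rw [← zero_add 1]
  unfold levels
  rw [Ordinal.limitRecOn_add_one, if_pos rfl]

theorem levels_add_one {α : Ordinal.{0}} (hα : α ≠ 0) :
    levels base step (α + 1) = step (levels base step α) := by
  unfold levels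
  rw [Ordinal.limitRecOn_add_one, if_neg hα]

theorem levels_limit {α : Ordinal.{0}} (hα : Order.IsSuccLimit α) :
    levels base step α = ⋃ β : Iio α, levels base step β := by
  rw [levels, Ordinal.limitRecOn_limit _ _ _ _ hα, iUnion_subtype]
  rfl

theorem levels_induction₂ {Q : Set P → Set P' → Prop} (hbase : Q base base')
    (hstep : ∀ S S', Q S S' → Q (step S) (step' S'))
    (hunion : ∀ (ι : Type 1) [Nonempty ι] (S : ι → Set P) (S' : ι → Set P'),
      (∀ i, Q (S i) (S' i)) → Q (⋃ i, S i) (⋃ i, S' i)) (α : Ordinal.{0}) :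
    Q (levels base step α) (levels base' step' α) := by
  induction α using Ordinal.limitRecOn with
  | zero => rwa [levels_zero, levels_zero]
  | add_one α ih =>
    rcases eq_or_ne α 0 with rfl | hα
    · rwa [zero_add, levels_one, levels_one]
    · rw [levels_add_one hα, levels_add_one hα]
      exact hstep _ _ ih
  | limit α hα ih =>
    rw [levels_limit hα, levels_limit hα]
    have : Nonempty (Iio α) := ⟨⟨0, hα.bot_lt⟩⟩
    exact hunion _ _ _ fun β => ih β.1 β.2

theorem levels_induction {Q : Set P → Prop} (hbase : Q base) (hstep : ∀ S, Q S → Q (step S))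
    (hunion : ∀ (ι : Type 1) [Nonempty ι] (S : ι → Set P), (∀ i, Q (S i)) → Q (⋃ i, S i))
    (α : Ordinal.{0}) : Q (levels base step α) :=
  levels_induction₂ (Q := fun S _ => Q S) (base' := base) (step' := step) hbase
    (fun S _ => hstep S) (fun ι _ S _ => hunion ι S) α

theorem levels_mono (hstep : ∀ S, S ⊆ step S) : Monotone (levels base step) := by
  intro α β h
  rcases h.lt_or_eq with h | rfl
  · induction β using Ordinal.limitRecOn with
    | zero => exact absurd h not_lt_zero
    | add_one β ih =>
      have subset_succ : levels base step β ⊆ levels base step (β + 1) := by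
        rcases eq_or_ne β 0 with rfl | hβ
        · rw [zero_add, levels_one, levels_zero]
        · rw [levels_add_one hβ]
          exact hstep _
      rcases (Order.lt_add_one_iff.1 h).lt_or_eq with h | rfl
      · exact (ih h.le h).trans subset_succ
      · exact subset_succ
    | limit β hβ _ =>
      rw [levels_limit hβ]
      exact subset_iUnion (fun γ : Iio β => levels base step γ) ⟨α, h⟩
  · exact subset_rfl

theorem exists_closure_eq_of_monotone {X : Type*} [TopologicalSpace X] [SecondCountableTopology X]
    {S : Ordinal.{0} → Set X} (hS : Monotone S) :
    ∃ α, 1 ≤ α ∧ α < Ordinal.omega 1 ∧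
      ∀ β, α ≤ β → β < Ordinal.omega 1 → closure (S β) = closure (S α) := by
  let meets (U : TopologicalSpace.countableBasis X) : Set Ordinal.{0} :=
    {α | α < Ordinal.omega 1 ∧ (U.1 ∩ S α).Nonempty}
  have one_lt : (1 : Ordinal.{0}) < Ordinal.omega 1 :=
    Ordinal.one_lt_omega0.trans Ordinal.omega0_lt_omega_one
  have sInf_meets_lt (U) : sInf (meets U) < Ordinal.omega 1 := by
    rcases (meets U).eq_empty_or_nonempty with h | h
    · rw [h, Ordinal.sInf_empty]
      exact zero_lt_one.trans one_lt
    · exact (csInf_mem h).1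
  refine ⟨max 1 (⨆ U, sInf (meets U)), le_max_left _ _,
    max_lt one_lt (Ordinal.iSup_lt_omega_one sInf_meets_lt), fun β hβ hβ' => ?_⟩
  refine Subset.antisymm (fun x hx => ?_) (closure_mono (hS hβ))
  rw [(TopologicalSpace.isBasis_countableBasis X).mem_closure_iff] at hx ⊢
  intro U hU hxU
  have meets_nonempty : (meets ⟨U, hU⟩).Nonempty := ⟨β, hβ', hx U hU hxU⟩
  refine (csInf_mem meets_nonempty).2.mono (inter_subset_inter_right _ (hS ?_))
  exact (Ordinal.le_iSup (fun U => sInf (meets U)) ⟨U, hU⟩).trans (le_max_right _ _)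

end Levels

/-! ### The fabric image of a relation -/

section TransitiveClosure

variable {Z : Type u} {X : Set Z} {R S : Set (Z × Z)}

theorem subset_transClosure (R : Set (Z × Z)) : R ⊆ transClosure R :=
  fun _ hp => Relation.TransGen.single hp

theorem transClosure_subset (h : R ⊆ S) (trans : ∀ x y z, (x, y) ∈ S → (y, z) ∈ S → (x, z) ∈ S) :
    transClosure R ⊆ S := fun _ hp =>
  Relation.TransGen.trans_induction_on (motive := fun {a b} _ => (a, b) ∈ S) hp
    (fun hab => h hab) fun _ _ => trans _ _ _

theorem transClosure_trans {x y z : Z} (h : (x, y) ∈ transClosure R)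
    (h' : (y, z) ∈ transClosure R) : (x, z) ∈ transClosure R :=
  Relation.TransGen.trans h h'

theorem transSymmClosure_subset (h : R ⊆ S) (hS : IsEquivOn X S) : transSymmClosure R ⊆ S :=
  fun _ hp => Relation.TransGen.trans_induction_on (motive := fun {a b} _ => (a, b) ∈ S) hp
    (fun hab => hab.elim (fun hab => h hab) fun hba => hS.2.1 _ _ (h hba)) fun _ _ => hS.2.2 _ _ _

theorem transSymmClosure_eq_transClosure (symm : ∀ p ∈ R, p.swap ∈ R) :
    transSymmClosure R = transClosure R := by
  have : Relation.SymmGen (fun a b => (a, b) ∈ R) = fun a b => (a, b) ∈ R := by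
    ext a b
    exact or_iff_left_of_imp (symm (b, a))
  rw [transSymmClosure, this, transClosure]

theorem IsEquivOn.transSymmClosure_eq (hR : IsEquivOn X R) : transSymmClosure R = R :=
  (transSymmClosure_subset subset_rfl hR).antisymm fun _ hp => .single (.inl hp)

end TransitiveClosure

section Relations

variable {A : Type u} {W : Set (Config A)} {R S : Set (Config A × Config A)}

theorem fabricRel_subset_iff (hS : IsBishiftInvariant S) :
    fabricRel R ⊆ fabricRel S ↔ R ⊆ S := by
  refine ⟨fun h => ?_, fabricRel_mono⟩
  rintro ⟨x, x'⟩ hx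
  obtain ⟨y, hy⟩ := fabric_nonempty x
  obtain ⟨y', hy'⟩ := fabric_nonempty x'
  exact hS.mem_of_mem_fabricRel (h (mem_fabricRel.2 ⟨_, hx, hy, hy'⟩)) hy hy'

theorem fabricRel_inj (hR : IsBishiftInvariant R) (hS : IsBishiftInvariant S) :
    fabricRel R = fabricRel S ↔ R = S := by
  simp only [subset_antisymm_iff, fabricRel_subset_iff hS, fabricRel_subset_iff hR]

theorem isClosed_fabricRel_iff [TopologicalSpace A] [Finite A] [DiscreteTopology A]
    (hR : IsBishiftInvariant R) : IsClosed (fabricRel R) ↔ IsClosed R := by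
  rw [← closure_eq_iff_isClosed, ← fabricRel_closure hR, fabricRel_inj hR.closure hR,
    closure_eq_iff_isClosed]

theorem fabricRel_iUnion {ι : Sort*} (R : ι → Set (Config A × Config A)) :
    fabricRel (⋃ i, R i) = ⋃ i, fabricRel (R i) :=
  biUnion_iUnion _ _

theorem IsBishiftInvariant.transClosure (hR : IsBishiftInvariant R) :
    IsBishiftInvariant (transClosure R) := by
  rintro g h ⟨x, x'⟩ hp
  change Relation.TransGen _ (shift g x) (shift h x')
  replace hp : Relation.TransGen (fun a b => (a, b) ∈ R) x x' := hp
  induction hp generalizing h with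
  | single hab => exact .single (hR g h _ hab)
  | tail _ hbc ih => exact (ih 0).tail (hR 0 h _ (by simpa only [shift_zero] using hbc))

theorem fabricRel_trans (hR : IsBishiftInvariant R)
    (trans : ∀ x y z, (x, y) ∈ R → (y, z) ∈ R → (x, z) ∈ R) {a b c : Config (Symbol A)}
    (hab : (a, b) ∈ fabricRel R) (hbc : (b, c) ∈ fabricRel R) : (a, c) ∈ fabricRel R := by
  obtain ⟨⟨x, y⟩, -, hx, -⟩ := mem_fabricRel.1 hab
  obtain ⟨⟨y', z⟩, hyz, hy, hz⟩ := mem_fabricRel.1 hbc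
  exact mem_fabricRel.2 ⟨(x, z), trans _ _ _ (hR.mem_of_mem_fabricRel hab hx hy) hyz, hx, hz⟩

theorem fabricRel_transClosure (hR : IsBishiftInvariant R) :
    fabricRel (transClosure R) = transClosure (fabricRel R) := by
  refine Subset.antisymm ?_ (transClosure_subset (fabricRel_mono (subset_transClosure R))
    fun _ _ _ => fabricRel_trans hR.transClosure fun _ _ _ => transClosure_trans)
  rintro ⟨y, y'⟩ h
  obtain ⟨⟨x, x'⟩, hx, hy, hy'⟩ := mem_fabricRel.1 h
  have lift {b : Config A} (hb : Relation.TransGen (fun a b => (a, b) ∈ R) x b)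
      {z : Config (Symbol A)} (hz : z ∈ fabric b) : (y, z) ∈ transClosure (fabricRel R) := by
    induction hb generalizing z with
    | single hxb => exact .single (mem_fabricRel.2 ⟨_, hxb, hy, hz⟩)
    | @tail b c _ hbc ih =>
      obtain ⟨w, hw⟩ := fabric_nonempty b
      exact (ih hw).tail (mem_fabricRel.2 ⟨_, hbc, hw, hz⟩)
  exact lift hx hy'

/-- A reflexive, symmetric relation on `W` that is invariant under independent shifts of both
points. All the relations `T W α` on a subshift `W` have these properties. -/
structure IsShiftTolerance (W : Set (Config A)) (R : Set (Config A × Config A)) : Prop where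
  subset : R ⊆ W ×ˢ W
  refl : ∀ x ∈ W, (x, x) ∈ R
  symm : ∀ p ∈ R, p.swap ∈ R
  bishift : IsBishiftInvariant R

theorem IsShiftTolerance.transClosure (hR : IsShiftTolerance W R) :
    IsShiftTolerance W (transClosure R) where
  subset := transClosure_subset hR.subset fun _ _ _ h h' => ⟨h.1, h'.2⟩
  refl x hx := subset_transClosure R (hR.refl x hx)
  symm p hp := by
    have : Std.Symm (fun a b => (a, b) ∈ R) := ⟨fun a b hab => hR.symm _ hab⟩
    exact Relation.TransGen.stdSymm.symm _ _ hp
  bishift := hR.bishift.transClosure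

theorem IsShiftTolerance.closure [TopologicalSpace A] (hW : IsClosed W)
    (hR : IsShiftTolerance W R) : IsShiftTolerance W (closure R) where
  subset := closure_minimal hR.subset (hW.prod hW)
  refl x hx := subset_closure (hR.refl x hx)
  symm _ hp := map_mem_closure continuous_swap hp hR.symm
  bishift := hR.bishift.closure

theorem IsShiftTolerance.iUnion {ι : Type*} [Nonempty ι] {R : ι → Set (Config A × Config A)}
    (hR : ∀ i, IsShiftTolerance W (R i)) : IsShiftTolerance W (⋃ i, R i) where
  subset := iUnion_subset fun i => (hR i).subset
  refl x hx := mem_iUnion.2 ⟨Classical.arbitrary ι, (hR _).refl x hx⟩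
  symm p hp := by
    obtain ⟨i, hi⟩ := mem_iUnion.1 hp
    exact mem_iUnion.2 ⟨i, (hR i).symm p hi⟩
  bishift g h p hp := by
    obtain ⟨i, hi⟩ := mem_iUnion.1 hp
    exact mem_iUnion.2 ⟨i, (hR i).bishift g h p hi⟩

theorem IsShiftTolerance.swap_mem_fabricRel (hR : IsShiftTolerance W R)
    (p : Config (Symbol A) × Config (Symbol A)) (hp : p ∈ fabricRel R) : p.swap ∈ fabricRel R := by
  obtain ⟨q, hq, h, h'⟩ := mem_fabricRel.1 hp
  exact mem_fabricRel.2 ⟨q.swap, hR.symm q hq, h', h⟩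

theorem isEquivOn_fabricRel (hR : IsShiftTolerance W R) (h : transClosure R = R) :
    IsEquivOn (fabricSet W) (fabricRel R) := by
  refine ⟨fun y hy => ?_, fun y y' hy => hR.swap_mem_fabricRel (y, y') hy, fun _ _ _ =>
    fabricRel_trans hR.bishift fun _ _ _ hxy hyz => h ▸ Relation.TransGen.head hxy (.single hyz)⟩
  obtain ⟨x, hx, hy⟩ := mem_fabricSet.1 hy
  exact mem_fabricRel.2 ⟨_, hR.refl x hx, hy, hy⟩

end Relations

/-! ### Comparison of the two hierarchies -/

section Hierarchies

variable {A : Type u} {W : Set (Config A)} {R : Set (Config A × Config A)}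

theorem Pattern.AppearsIn.of_shift {w : Pattern A} {x : Config A} {g : ℤ × ℤ}
    (h : w.AppearsIn (shift g x)) : w.AppearsIn x := by
  obtain ⟨k, hk⟩ := h
  exact ⟨k - g, fun s => by rw [← hk s, shift, add_sub_assoc]⟩

theorem isShiftTolerance_transitivityPairs (hW : ∀ g : ℤ × ℤ, ∀ x ∈ W, shift g x ∈ W) :
    IsShiftTolerance W (transitivityPairs W) where
  subset _ hp := ⟨hp.1, hp.2.1⟩
  refl x hx := ⟨hx, hx, fun _ _ hv hv' => ⟨x, hx, hv, hv'⟩⟩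
  symm p hp := ⟨hp.2.1, hp.1, fun v v' hv hv' => by
    obtain ⟨z, hz, h, h'⟩ := hp.2.2 v' v hv' hv
    exact ⟨z, hz, h', h⟩⟩
  bishift g h p hp := ⟨hW g _ hp.1, hW h _ hp.2.1,
    fun v v' hv hv' => hp.2.2 v v' hv.of_shift hv'.of_shift⟩

variable [TopologicalSpace A]

theorem entropyStep_eq (X : Set (Config A)) (R : Set (Config A × Config A)) :
    entropyStep X R = open Classical in if IsClosed R then transSymmClosure R else closure R := by
  unfold entropyStep
  split_ifs with _ h
  exacts [h.transSymmClosure_eq.symm, rfl, rfl]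

theorem IsShiftTolerance.transitivityStep (hW : IsClosed W) (hR : IsShiftTolerance W R) :
    IsShiftTolerance W (transitivityStep R) := by
  unfold Fabric.transitivityStep
  split_ifs
  exacts [hR.transClosure, hR.closure hW]

theorem subset_transitivityStep (R : Set (Config A × Config A)) : R ⊆ transitivityStep R := by
  unfold transitivityStep
  split_ifs
  exacts [subset_transClosure R, subset_closure]

theorem isShiftTolerance_T (hW : IsSubshift W) (α : Ordinal.{0}) : IsShiftTolerance W (T W α) :=
  levels_induction (isShiftTolerance_transitivityPairs hW.shift_mem)
    (fun _ hR => hR.transitivityStep hW.isClosed) (fun _ _ _ => .iUnion) α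

variable [Finite A]

theorem exists_isClosed_transClosure_eq (W : Set (Config A)) :
    ∃ α, 1 ≤ α ∧ α < Ordinal.omega 1 ∧ IsClosed (T W α) ∧ transClosure (T W α) = T W α := by
  have step_eq (α) (hα : 1 ≤ α) : T W (α + 1) = transitivityStep (T W α) :=
    levels_add_one (zero_lt_one.trans_le hα).ne'
  have add_one_lt {α} (hα : α < Ordinal.omega 1) := (Cardinal.isSuccLimit_omega 1).add_one_lt hα
  obtain ⟨α, h1, hα, closure_eq⟩ :=
    exists_closure_eq_of_monotone (S := T W) (levels_mono subset_transitivityStep)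
  obtain ⟨β, hαβ, hβ, closed⟩ : ∃ β, α ≤ β ∧ β < Ordinal.omega 1 ∧ IsClosed (T W β) := by
    by_cases h : IsClosed (T W α)
    · exact ⟨α, le_rfl, hα, h⟩
    · refine ⟨α + 1, le_self_add, add_one_lt hα, ?_⟩
      rw [step_eq α h1, transitivityStep, if_neg h]
      exact isClosed_closure
  refine ⟨β, h1.trans hαβ, hβ, closed, Subset.antisymm ?_ (subset_transClosure _)⟩
  calc transClosure (T W β)
    _ = T W (β + 1) := by rw [step_eq β (h1.trans hαβ), transitivityStep, if_pos closed]
    _ ⊆ closure (T W (β + 1)) := subset_closure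
    _ = closure (T W α) := closure_eq _ (hαβ.trans le_self_add) (add_one_lt hβ)
    _ = T W β := by rw [← closure_eq β hαβ hβ, closed.closure_eq]

variable [DiscreteTopology A]

theorem fabricRel_transitivityStep (X : Set (Config (Symbol A))) (hR : IsShiftTolerance W R) :
    fabricRel (transitivityStep R) = entropyStep X (fabricRel R) := by
  rw [entropyStep_eq, transitivityStep, apply_ite fabricRel, isClosed_fabricRel_iff hR.bishift,
    fabricRel_transClosure hR.bishift, transSymmClosure_eq_transClosure hR.swap_mem_fabricRel,
    fabricRel_closure hR.bishift]

end Hierarchies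

/-! ### Truncating and gluing displacements -/

section Gluing

theorem abs_clamp_sub_clamp_le {a b s t : ℤ} (h : |a - b| ≤ 1) (h' : |s - t| ≤ 1) :
    |max (min a s) (-s) - max (min b t) (-t)| ≤ 1 := by
  rw [abs_le] at *
  omega

/-- A positive displacement with bounded support, of height about `L` near the origin. -/
def cone (L i n : ℤ) : ℤ := max 0 (L - |i| - (|n| + 1) / 2)

theorem isDisplacement_cone (L : ℤ) : IsDisplacement (cone L) where
  step_one i n := by
    rw [cone, cone, abs_le]
    cases abs_cases n <;> cases abs_cases (n + 1) <;> omega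
  step_two i n := by
    rw [cone, cone, abs_le]
    cases abs_cases n <;> cases abs_cases (n + 2) <;> omega
  step_index i n := by
    rw [cone, cone, abs_le]
    cases abs_cases i <;> cases abs_cases (i + 1) <;> omega

theorem cone_eq_zero {L i n : ℤ} (h : (i, n) ∉ box (2 * |L|)) : cone L i n = 0 := by
  have := le_abs_self L
  have := abs_nonneg i
  have := abs_nonneg n
  simp only [mem_box] at h
  rw [cone]
  omega

theorem IsDisplacement.clamp {d e : ℤ → ℤ → ℤ} (hd : IsDisplacement d) (he : IsDisplacement e) :
    IsDisplacement fun i n => max (min (d i n) (e i n)) (-e i n) where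
  step_one i n := abs_clamp_sub_clamp_le (hd.step_one i n) (he.step_one i n)
  step_two i n := abs_clamp_sub_clamp_le (hd.step_two i n) (he.step_two i n)
  step_index i n := abs_clamp_sub_clamp_le (hd.step_index i n) (he.step_index i n)

theorem IsDisplacement.exists_truncate {d : ℤ → ℤ → ℤ} (hd : IsDisplacement d) (N : ℤ) :
    ∃ M, ∃ d', IsDisplacement d' ∧ EqOn d'.uncurry d.uncurry (box N) ∧
      ∀ i n, (i, n) ∉ box M → d' i n = 0 := by
  set C := ∑ p ∈ box N, |d p.1 p.2|
  refine ⟨2 * |C + 2 * N + 1|, _, hd.clamp (isDisplacement_cone (C + 2 * N + 1)), ?_, ?_⟩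
  · rintro ⟨i, n⟩ hp
    have bound : |d i n| ≤ C :=
      Finset.single_le_sum (f := fun p : ℤ × ℤ => |d p.1 p.2|) (fun _ _ => abs_nonneg _) hp
    obtain ⟨hi, hn⟩ := mem_box.1 hp
    have := abs_le.1 bound
    have := abs_nonneg n
    simp only [Function.uncurry_apply_pair, cone] at *
    omega
  · intro i n h
    simp [cone_eq_zero h]

theorem ediv_eq_of_abs_sub_le {L M a i : ℤ} (hL : 2 * M < L) (h : |i - L * a| ≤ M) :
    (i + M) / L = a := by
  rw [abs_le] at h
  have e : i + M = (i - L * a + M) + L * a := by ring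
  rw [e, Int.add_mul_ediv_left _ _ (by omega), Int.ediv_eq_zero_of_lt (by omega) (by omega),
    zero_add]

/-- Places the displacements `d a b`, supported in `box M`, side by side, with `d a b` centred
at the position `3 * L * b` of the ribbon `L * a`. Since ribbons are at distance about `3`, the
cells are squares of side `3 * L` in the plane. -/
def glued (L M : ℤ) (d : ℤ → ℤ → ℤ → ℤ → ℤ) (i n : ℤ) : ℤ :=
  let a := (i + (M + 2)) / L
  let b := (n + (M + 2)) / (3 * L)
  d a b (i - L * a) (n - 3 * L * b)

variable {L M : ℤ} {d : ℤ → ℤ → ℤ → ℤ → ℤ}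

theorem glued_eq (hL : 2 * M + 4 < L) (a b : ℤ) {i n : ℤ} (hi : |i - L * a| ≤ M + 2)
    (hn : |n - 3 * L * b| ≤ M + 2) : glued L M d i n = d a b (i - L * a) (n - 3 * L * b) := by
  have := (abs_nonneg _).trans hi
  rw [glued, ediv_eq_of_abs_sub_le (by omega) hi, ediv_eq_of_abs_sub_le (by omega) hn]

theorem exists_glued_eq_of_near (hL : 2 * M + 4 < L)
    (hsupp : ∀ a b i n, (i, n) ∉ box M → d a b i n = 0) {i n i' n' : ℤ} (hi : |i' - i| ≤ 2)
    (hn : |n' - n| ≤ 2) :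
    ∃ a b, glued L M d i n = d a b (i - L * a) (n - 3 * L * b) ∧
      glued L M d i' n' = d a b (i' - L * a) (n' - 3 * L * b) := by
  set a := (i + (M + 2)) / L
  set b := (n + (M + 2)) / (3 * L)
  set a' := (i' + (M + 2)) / L
  set b' := (n' + (M + 2)) / (3 * L)
  by_cases h : (i - L * a, n - 3 * L * b) ∈ box M
  · obtain ⟨h1, h2⟩ := mem_box.1 h
    exact ⟨a, b, rfl, glued_eq hL a b (by grind) (by grind)⟩
  · refine ⟨a', b', ?_, rfl⟩
    by_cases h' : (i - L * a', n - 3 * L * b') ∈ box M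
    · obtain ⟨h1, h2⟩ := mem_box.1 h'
      exact glued_eq hL a' b' (by grind) (by grind)
    · rw [hsupp a' b' _ _ h']
      exact hsupp a b _ _ h

theorem isDisplacement_glued (hL : 2 * M + 4 < L)
    (hsupp : ∀ a b i n, (i, n) ∉ box M → d a b i n = 0) (hd : ∀ a b, IsDisplacement (d a b)) :
    IsDisplacement (glued L M d) where
  step_one i n := by
    obtain ⟨a, b, h, h'⟩ := exists_glued_eq_of_near hL hsupp (i := i) (n := n) (i' := i)
      (n' := n + 1) (by simp) (by simp)
    rw [h, h', add_sub_right_comm]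
    exact (hd a b).step_one _ _
  step_two i n := by
    obtain ⟨a, b, h, h'⟩ := exists_glued_eq_of_near hL hsupp (i := i) (n := n) (i' := i)
      (n' := n + 2) (by simp) (by simp)
    rw [h, h', add_sub_right_comm]
    exact (hd a b).step_two _ _
  step_index i n := by
    obtain ⟨a, b, h, h'⟩ := exists_glued_eq_of_near hL hsupp (i := i) (n := n) (i' := i + 1)
      (n' := n) (by simp) (by simp)
    rw [h, h', add_sub_right_comm]
    exact (hd a b).step_index _ _

theorem exists_isRibbonFamily_glue {ι : Type*} [Finite ι] {R : ι → ℤ → ℤ → ℤ}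
    (hR : ∀ k, IsRibbonFamily (R k)) (N : ℤ) :
    ∃ L₀, ∀ L > L₀, ∀ c : ℤ → ℤ → ι, ∃ Q, IsRibbonFamily Q ∧ ∀ a b, ∀ p ∈ box N,
      Q (p.1 + L * a) (p.2 + 3 * L * b) = R (c a b) p.1 p.2 + 3 * L * a := by
  choose M d hd heq hsupp using fun k => (hR k).isDisplacement.exists_truncate N
  obtain ⟨C, hC⟩ := (finite_range M).bddAbove
  have hMC (k : ι) : M k ≤ max C N := (hC (mem_range_self k)).trans (le_max_left _ _)
  refine ⟨2 * max C N + 4, fun L hL c => ⟨_, (isDisplacement_glued (M := max C N) hL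
    (d := fun a b => d (c a b)) (fun a b i n h => hsupp _ i n fun h' => h ?_)
    fun a b => hd _).isRibbonFamily, fun a b p hp => ?_⟩⟩
  · rw [mem_box] at h' ⊢
    exact ⟨h'.1.trans (hMC _), h'.2.trans (hMC _)⟩
  · obtain ⟨hi, hn⟩ := mem_box.1 hp
    have key := heq (c a b) hp
    simp only [Function.uncurry] at key
    rw [glued_eq hL a b (by rw [add_sub_cancel_right]; omega)
      (by rw [add_sub_cancel_right]; omega), add_sub_cancel_right, add_sub_cancel_right, key]
    ring

end Gluing

/-! ### Independent weaving -/

theorem exists_abs_le {ι : Type*} [Finite ι] (f : ι → ℤ) : ∃ C, ∀ b, |f b| ≤ C := by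
  obtain ⟨C, hC⟩ := (finite_range fun b => |f b|).bddAbove
  exact ⟨C, fun b => hC (mem_range_self b)⟩

theorem exists_mem_fabric_forall_eqOn {A : Type u} {ι : Type*} [Finite ι] {H V : ι → ℤ → ℤ → ℤ}
    {x : ι → Config A} {y : ι → Config (Symbol A)} (hH : ∀ b, IsRibbonFamily (H b))
    (hV : ∀ b, IsRibbonFamily (V b)) (hy : ∀ b, IsWeave (H b) (V b) (x b) (y b)) {N I : ℤ}
    (hI : ∀ b, N + |H b 0 0| + |V b 0 0| + 1 ≤ I) (k : ι → ℤ × ℤ) :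
    ∃ L : ℤ, 0 < L ∧ ∀ (z : Config A) (G : Set (ℤ × ℤ)),
      (∀ a ∈ G, ∀ b, EqOn (x b) (fun p => shift (L • a) z (p + k b)) (box I)) →
      ∀ s : ℤ × ℤ → ι, ∃ u ∈ fabric z, ∀ a ∈ G,
        EqOn (y (s a)) (shift ((3 * L) • a) u) (box N) := by
  obtain ⟨K₁, hK₁⟩ := exists_abs_le fun b => (k b).1
  obtain ⟨K₂, hK₂⟩ := exists_abs_le fun b => (k b).2
  obtain ⟨L₁, hL₁⟩ :=
    exists_isRibbonFamily_glue (fun b => (hH b).translate (-(k b).2) 0 0) (I + K₂)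
  obtain ⟨L₂, hL₂⟩ :=
    exists_isRibbonFamily_glue (fun b => (hV b).translate (-(k b).1) 0 0) (I + K₁)
  refine ⟨max 0 (max L₁ L₂) + 1, by omega, fun z G hG s => ?_⟩
  set L := max 0 (max L₁ L₂) + 1
  obtain ⟨P, hP, hPeq⟩ := hL₁ L (by omega) fun a b => s (-b, -a)
  obtain ⟨Q, hQ, hQeq⟩ := hL₂ L (by omega) fun a b => s (-a, -b)
  obtain ⟨u, hu⟩ := exists_isWeave hP hQ z
  refine ⟨u, ⟨P, Q, hP, hQ, hu⟩, fun a ha q hq => ?_⟩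
  obtain ⟨b, hb⟩ : ∃ b, s a = b := ⟨_, rfl⟩
  have mem_box_add {i n c K : ℤ} (hp : (i, n) ∈ box I) (hc : |c| ≤ K) :
      (i + c, n) ∈ box (I + K) := by
    obtain ⟨hi, hn⟩ := mem_box.1 hp
    exact mem_box.2 ⟨(abs_add_le i c).trans (add_le_add hi hc),
      hn.trans (le_add_of_nonneg_right ((abs_nonneg _).trans hc))⟩
  rw [hb]
  refine ((hy b).eq_of_eqOn (hu.translate (-((3 * L) • a)) (k b + -(L • a))) hq (hH b) (hV b)
    (hP.translate _ _ _) (hQ.translate _ _ _) (hI b) ?_ ?_ ?_).trans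
    (congrArg u (sub_eq_add_neg _ _).symm)
  · rintro ⟨i, n⟩ hp
    have := hPeq (-a.2) (-a.1) _ (mem_box_add hp (hK₂ b))
    simp_all [Function.uncurry, add_assoc]
  · rintro ⟨j, m⟩ hp
    have := hQeq (-a.1) (-a.2) _ (mem_box_add hp (hK₁ b))
    simp_all [Function.uncurry, add_assoc]
  · exact fun p hp => (hG a ha b hp).trans
      (congrArg z (show p + k b - L • a = p + (k b + -(L • a)) by abel))

/-! ### Covers and their entropy -/

section Covers

variable {Z : Type u} {X : Set Z} {act : ℤ × ℤ → Z → Z} {𝒰 𝒱 : Set (Set Z)}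

theorem minCover_le {F : Finset (Set Z)} (hF : ↑F ⊆ 𝒱) (hX : X ⊆ ⋃₀ F) : minCover X 𝒱 ≤ F.card :=
  Nat.sInf_le ⟨F, hF, hX, rfl⟩

theorem exists_card_eq_minCover (h : ∃ F : Finset (Set Z), ↑F ⊆ 𝒱 ∧ X ⊆ ⋃₀ F) :
    ∃ F : Finset (Set Z), ↑F ⊆ 𝒱 ∧ X ⊆ ⋃₀ F ∧ F.card = minCover X 𝒱 := by
  obtain ⟨F, hF, hX⟩ := h
  exact Nat.sInf_mem (s := {k | ∃ F : Finset (Set Z), (F : Set (Set Z)) ⊆ 𝒱 ∧ X ⊆ ⋃₀ F ∧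
    F.card = k}) ⟨F.card, F, hF, hX, rfl⟩

theorem finite_coverJoin (act : ℤ × ℤ → Z → Z) (h𝒰 : 𝒰.Finite) (n : ℕ) :
    (coverJoin act 𝒰 n).Finite := by
  have : Finite 𝒰 := h𝒰
  have : Finite (Ico (0 : ℤ) n ×ˢ Ico (0 : ℤ) n) := (finite_Ico _ _).prod (finite_Ico _ _)
  refine (finite_range fun c : (Ico (0 : ℤ) n ×ˢ Ico (0 : ℤ) n) → 𝒰 =>
    {z | ∀ g, act g.1 z ∈ (c g).1}).subset ?_
  rintro P ⟨c, hc, rfl⟩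
  exact ⟨fun g => ⟨c g, hc g⟩, by ext z; simp⟩

theorem exists_finset_coverJoin (act : ℤ × ℤ → Z → Z) (X : Set Z) (h𝒰 : 𝒰.Finite)
    (hcover : ⋃₀ 𝒰 = univ) (n : ℕ) :
    ∃ F : Finset (Set Z), ↑F ⊆ coverJoin act 𝒰 n ∧ X ⊆ ⋃₀ F := by
  refine ⟨(finite_coverJoin act h𝒰 n).toFinset, by simp, fun z _ => ?_⟩
  choose c hc hz using fun g => sUnion_eq_univ_iff.1 hcover (act g z)
  exact ⟨{z | ∀ g ∈ Ico (0 : ℤ) n ×ˢ Ico (0 : ℤ) n, act g z ∈ c g},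
    (Finite.mem_toFinset _).2 ⟨c, hc, rfl⟩, fun g _ => hz g⟩

theorem card_le_minCover {ι : Type*} [Fintype ι] (h : ∃ F : Finset (Set Z), ↑F ⊆ 𝒱 ∧ X ⊆ ⋃₀ F)
    {z : ι → Z} (hz : ∀ i, z i ∈ X) (hsep : ∀ P ∈ 𝒱, ∀ i j, z i ∈ P → z j ∈ P → i = j) :
    Fintype.card ι ≤ minCover X 𝒱 := by
  obtain ⟨F, hF, hX, hcard⟩ := exists_card_eq_minCover h
  rw [← hcard, ← Fintype.card_coe]
  choose P hP hzP using fun i => hX (hz i)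
  refine Fintype.card_le_of_injective (fun i => (⟨P i, hP i⟩ : F)) fun i j hij => ?_
  have hij : P i = P j := congrArg Subtype.val hij
  exact hsep (P i) (hF (hP i)) i j (hzP i) (hij ▸ hzP j)

theorem log_natCast_le_log_natCast {a b : ℕ} (h : a ≤ b) : Real.log a ≤ Real.log b := by
  rcases Nat.eq_zero_or_pos a with rfl | h0
  · simpa using Real.log_natCast_nonneg b
  · exact Real.log_le_log (by exact_mod_cast h0) (by exact_mod_cast h)

theorem coverEntropy_nonpos_of_orbits {F : Finset (Set Z)} (hF : ↑F ⊆ 𝒰)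
    (horbit : ∀ z ∈ X, ∃ U ∈ F, ∀ g, act g z ∈ U) : coverEntropy act X 𝒰 ≤ 0 := by
  classical
  have hcard (n : ℕ) : minCover X (coverJoin act 𝒰 n) ≤ F.card := by
    refine (minCover_le (F := F.image fun U => {z | ∀ g ∈ Ico (0 : ℤ) n ×ˢ Ico (0 : ℤ) n,
      act g z ∈ U}) ?_ fun z hz => ?_).trans Finset.card_image_le
    · intro P hP
      obtain ⟨U, hU, rfl⟩ := Finset.mem_image.1 hP
      exact ⟨fun _ => U, fun _ => hF hU, rfl⟩
    · obtain ⟨U, hU, hz⟩ := horbit z hz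
      exact ⟨_, Finset.mem_image_of_mem _ hU, fun g _ => hz g⟩
  have hlim : Tendsto (fun n : ℕ => ((Real.log F.card / (n : ℝ) ^ 2 : ℝ) : EReal)) atTop (𝓝 0) := by
    rw [← EReal.coe_zero, EReal.tendsto_coe]
    exact tendsto_const_nhds.div_atTop
      ((tendsto_pow_atTop two_ne_zero).comp tendsto_natCast_atTop_atTop)
  rw [← hlim.limsup_eq]
  refine limsup_le_limsup (Eventually.of_forall fun n => EReal.coe_le_coe_iff.2 ?_)
  exact div_le_div_of_nonneg_right (log_natCast_le_log_natCast (hcard n)) (by positivity)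

theorem coverEntropy_le_of_lift {Z' : Type*} {X' : Set Z'} {act' : ℤ × ℤ → Z' → Z'}
    {𝒰' : Set (Set Z')} (hfin : 𝒰'.Finite) (hcover : ⋃₀ 𝒰' = univ) {π : X → Z'}
    (hπ : ∀ z, π z ∈ X')
    (hlift : ∀ U ∈ 𝒰', ∃ V ∈ 𝒰, ∀ g (z : X), act' g (π z) ∈ U → act g z ∈ V) :
    coverEntropy act X 𝒰 ≤ coverEntropy act' X' 𝒰' := by
  classical
  have hlift_join (n : ℕ) : ∀ P ∈ coverJoin act' 𝒰' n,
      ∃ Q ∈ coverJoin act 𝒰 n, ∀ z : X, π z ∈ P → z.1 ∈ Q := by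
    choose! V hV hact using hlift
    rintro P ⟨c, hc, rfl⟩
    exact ⟨_, ⟨fun g => V (c g), fun g => hV _ (hc g), rfl⟩,
      fun z hz g hg => hact _ (hc g) g z (hz g hg)⟩
  refine limsup_le_limsup (Eventually.of_forall fun n => EReal.coe_le_coe_iff.2
    (div_le_div_of_nonneg_right (log_natCast_le_log_natCast ?_) (by positivity)))
  choose! Q hQ hπQ using hlift_join n
  obtain ⟨F, hF, hX', hcard⟩ :=
    exists_card_eq_minCover (exists_finset_coverJoin act' X' hfin hcover n)
  rw [← hcard]
  refine (minCover_le (F := F.image Q) ?_ fun z hz => ?_).trans Finset.card_image_le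
  · intro _ h
    obtain ⟨P, hP, rfl⟩ := Finset.mem_image.1 h
    exact hQ P (hF hP)
  · obtain ⟨P, hP, hzP⟩ := hX' (hπ ⟨z, hz⟩)
    exact ⟨Q P, Finset.mem_image_of_mem Q hP, hπQ P (hF hP) ⟨z, hz⟩ hzP⟩

theorem sUnion_pair_compl_eq_univ {K K' : Set Z} (h : Disjoint K K') :
    ⋃₀ {Kᶜ, K'ᶜ} = (univ : Set Z) := by
  rw [sUnion_pair, ← compl_inter, h.inter_eq, compl_empty]

/-! ### Independence sets -/

/-- `G` is an independence set for the sets `K b`: points of `X` can be steered, at the times of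
`G`, into any prescribed choice of these sets. -/
def IsIndependenceSet {ι : Type*} (act : ℤ × ℤ → Z → Z) (X : Set Z) (K : ι → Set Z)
    (G : Set (ℤ × ℤ)) : Prop :=
  ∀ c : ℤ × ℤ → ι, ∃ z ∈ X, ∀ g ∈ G, act g z ∈ K (c g)

variable {K : Bool → Set Z}

theorem IsIndependenceSet.two_pow_card_le_minCover {G : Finset (ℤ × ℤ)}
    (hG : IsIndependenceSet act X K G) (hK : Disjoint (K false) (K true)) {n : ℕ}
    (hGn : ↑G ⊆ Ico (0 : ℤ) n ×ˢ Ico (0 : ℤ) n) :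
    2 ^ G.card ≤ minCover X (coverJoin act {(K false)ᶜ, (K true)ᶜ} n) := by
  classical
  choose z hzX hz using fun c : G → Bool => hG fun g => if h : g ∈ G then c ⟨g, h⟩ else true
  have hzc (c : G → Bool) (g : G) : act g (z c) ∈ K (c g) := by simpa using hz c g g.2
  calc 2 ^ G.card = Fintype.card (G → Bool) := by simp
    _ ≤ _ := card_le_minCover (exists_finset_coverJoin act X (toFinite _)
        (sUnion_pair_compl_eq_univ hK) n) hzX ?_
  rintro _ ⟨C, hC, rfl⟩ c d hc hd
  ext1 g
  obtain ⟨b, hb⟩ : ∃ b, C g = (K b)ᶜ := (hC g).elim (fun h => ⟨_, h⟩) fun h => ⟨_, h⟩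
  have avoid (e : G → Bool) (he : act g (z e) ∈ C g) : e g = !b :=
    Bool.eq_not.2 fun heb => (hb ▸ he) (heb ▸ hzc e g)
  exact (avoid c (hc g (hGn g.2))).trans (avoid d (hd g (hGn g.2))).symm

theorem coverEntropy_pos_of_isIndependenceSet (hK : Disjoint (K false) (K true)) {δ : ℝ}
    (hδ : 0 < δ) (h : ∃ᶠ n : ℕ in atTop, ∃ G : Finset (ℤ × ℤ),
      ↑G ⊆ Ico (0 : ℤ) n ×ˢ Ico (0 : ℤ) n ∧ IsIndependenceSet act X K G ∧
        δ * (n : ℝ) ^ 2 ≤ G.card) :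
    0 < coverEntropy act X {(K false)ᶜ, (K true)ᶜ} := by
  have hlog : 0 < Real.log 2 := Real.log_pos one_lt_two
  refine (EReal.coe_pos.2 (mul_pos hδ hlog)).trans_le (le_limsup_of_frequently_le
    ((h.and_eventually (eventually_gt_atTop 0)).mono ?_))
  rintro n ⟨⟨G, hGn, hG, hcard⟩, hn⟩
  have hn : (0 : ℝ) < n := by exact_mod_cast hn
  rw [EReal.coe_le_coe_iff, le_div_iff₀ (pow_pos hn 2)]
  calc δ * Real.log 2 * (n : ℝ) ^ 2 = δ * (n : ℝ) ^ 2 * Real.log 2 := by ring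
    _ ≤ G.card * Real.log 2 := by gcongr
    _ = Real.log ((2 ^ G.card : ℕ) : ℝ) := by simp
    _ ≤ _ := log_natCast_le_log_natCast (hG.two_pow_card_le_minCover hK hGn)

theorem coverEntropy_pos_of_forall_exists_isIndependenceSet (hK : Disjoint (K false) (K true))
    {δ : ℝ} (hδ : 0 < δ) {L : ℤ} (hL : 0 < L)
    (h : ∀ B : Finset (ℤ × ℤ), ∃ G ⊆ B,
      IsIndependenceSet act X K ((L • ·) '' (G : Set (ℤ × ℤ))) ∧ δ * B.card ≤ G.card) :
    0 < coverEntropy act X {(K false)ᶜ, (K true)ᶜ} := by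
  classical
  lift L to ℕ using hL.le
  have hL : 0 < L := by exact_mod_cast hL
  refine coverEntropy_pos_of_isIndependenceSet hK (δ := δ / L ^ 2) (by positivity)
    (frequently_atTop.2 fun m => ?_)
  obtain ⟨G, hGm, hG, hcard⟩ := h (Finset.Ico (0 : ℤ) m ×ˢ Finset.Ico (0 : ℤ) m)
  refine ⟨L * m, Nat.le_mul_of_pos_left m hL, G.image ((L : ℤ) • ·), ?_,
    by rwa [Finset.coe_image], ?_⟩
  · rw [Finset.coe_image]
    rintro _ ⟨a, ha, rfl⟩
    have := hGm ha
    simp only [Finset.mem_product, Finset.mem_Ico] at this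
    obtain ⟨⟨h₁, h₁m⟩, h₂, h₂m⟩ := this
    push_cast
    refine ⟨⟨?_, ?_⟩, ?_, ?_⟩ <;> simp only [Prod.smul_fst, Prod.smul_snd, smul_eq_mul] <;>
      first | positivity | gcongr
  · have smul_injective : Function.Injective fun a : ℤ × ℤ => (L : ℤ) • a :=
      smul_right_injective _ (by exact_mod_cast hL.ne')
    rw [Finset.card_image_of_injective G smul_injective]
    have hL₀ : (L : ℝ) ≠ 0 := by exact_mod_cast hL.ne'
    have hB : δ * (m : ℝ) ^ 2 ≤ G.card := by simpa [sq] using hcard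
    refine le_of_eq_of_le ?_ hB
    push_cast
    field_simp

end Covers

/-! ### Entropy pairs of a fabric come from transitivity pairs -/

section EntropyPairs

variable {A : Type u} [TopologicalSpace A] [DiscreteTopology A]

theorem isOpen_setOf_appearsIn (v : Pattern A) : IsOpen {x : Config A | v.AppearsIn x} := by
  simp only [Pattern.AppearsIn, ofPred_exists, ofPred_forall]
  exact isOpen_iUnion fun g => isOpen_iInter_of_finite fun s =>
    (isOpen_discrete {v.val s}).preimage
      (show Continuous fun x : Config A => x (s.1 + g) by fun_prop)

variable [Finite A] {W : Set (Config A)} {x x' : Config A} {y y' : Config (Symbol A)}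
  {v v' : Pattern A}

theorem exists_isClosed_nhdsWithin_appearsIn (hW : IsSubshift W) (hv : v.AppearsIn x)
    (hy : y ∈ fabric x) :
    ∃ K, IsClosed K ∧ K ∈ 𝓝[fabricSet W] y ∧ ∀ u ∈ K, ∀ z, u ∈ fabric z → v.AppearsIn z := by
  have avoiding_isSubshift : IsSubshift (W \ {z | v.AppearsIn z}) :=
    ⟨hW.isClosed.sdiff (isOpen_setOf_appearsIn v),
      fun g z hz => ⟨hW.shift_mem g z hz.1, fun h => hz.2 h.of_shift⟩⟩
  have hyv : y ∈ (fabricSet (W \ {z | v.AppearsIn z}))ᶜ := fun h => by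
    obtain ⟨z, hz, hyz⟩ := mem_fabricSet.1 h
    obtain ⟨k, rfl⟩ := exists_eq_shift_of_mem_fabric hyz hy
    exact hz.2 hv.of_shift
  obtain ⟨K, hK, hKc, hKv⟩ := exists_mem_nhds_isClosed_subset
    ((isSubshift_fabricSet avoiding_isSubshift).isClosed.isOpen_compl.mem_nhds hyv)
  refine ⟨K ∩ fabricSet W, hKc.inter (isSubshift_fabricSet hW).isClosed,
    inter_mem (mem_nhdsWithin_of_mem_nhds hK) self_mem_nhdsWithin, fun u hu z huz => ?_⟩
  by_contra hzv
  obtain ⟨w, hw, huw⟩ := mem_fabricSet.1 hu.2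
  obtain ⟨k, rfl⟩ := exists_eq_shift_of_mem_fabric huw huz
  exact hKv hu.1 (mem_fabricSet.2 ⟨_, ⟨hW.shift_mem k w hw, hzv⟩, huz⟩)

theorem mem_transitivityPairs_of_isEntropyPair (hW : IsSubshift W) (hx : x ∈ W) (hx' : x' ∈ W)
    (hy : y ∈ fabric x) (hy' : y' ∈ fabric x') (h : IsEntropyPair (fabricSet W) y y') :
    (x, x') ∈ transitivityPairs W := by
  classical
  refine ⟨hx, hx', fun v v' hv hv' => ?_⟩
  by_contra! hne
  obtain ⟨K, hKc, hK, hKv⟩ := exists_isClosed_nhdsWithin_appearsIn hW hv hy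
  obtain ⟨K', hKc', hK', hKv'⟩ := exists_isClosed_nhdsWithin_appearsIn hW hv' hy'
  have no_orbit_visits_both {u} (hu : u ∈ fabricSet W) {g g'} (hg : shift g u ∈ K)
      (hg' : shift g' u ∈ K') : False := by
    obtain ⟨z, hz, huz⟩ := mem_fabricSet.1 hu
    exact hne z hz (hKv _ hg z (shift_mem_fabric g huz)) (hKv' _ hg' z (shift_mem_fabric g' huz))
  have hdisj : Disjoint (K ∩ fabricSet W) K' := Set.disjoint_left.2 fun u hu hu' =>
    no_orbit_visits_both (g := 0) (g' := 0) hu.2 (by rw [shift_zero]; exact hu.1)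
      (by rwa [shift_zero])
  refine (h.2.2.2 (K ∩ fabricSet W) K' (hKc.inter (isSubshift_fabricSet hW).isClosed) hKc'
    (inter_mem hK self_mem_nhdsWithin) hK' hdisj).not_ge (coverEntropy_nonpos_of_orbits
      (F := {(K ∩ fabricSet W)ᶜ, K'ᶜ}) (by simp) fun u hu => ?_)
  by_cases hg : ∃ g, shift g u ∈ K
  · obtain ⟨g, hg⟩ := hg
    exact ⟨K'ᶜ, by simp, fun g' hg' => no_orbit_visits_both hu hg hg'⟩
  · exact ⟨(K ∩ fabricSet W)ᶜ, by simp, fun g hgK => hg ⟨g, hgK.1⟩⟩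

end EntropyPairs

/-! ### Points that visit an open set often -/

section Density

theorem exists_sum_measureReal_le_card_filter {X ι : Type*} [MeasurableSpace X] (μ : Measure X)
    [IsProbabilityMeasure μ] {N : Set X} (hN : μ N = 0) (B : Finset ι) {S : ι → Set X}
    (hS : ∀ a, MeasurableSet (S a)) [∀ x, DecidablePred fun a => x ∈ S a] :
    ∃ x ∉ N, ∑ a ∈ B, μ.real (S a) ≤ ({a ∈ B | x ∈ S a} : Finset ι).card := by
  have integrable_indicator (a) (_ : a ∈ B) : Integrable ((S a).indicator (1 : X → ℝ)) μ :=
    (integrable_const 1).indicator (hS a)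
  obtain ⟨x, hx, hle⟩ :=
    exists_notMem_null_integral_le (integrable_finsetSum B integrable_indicator) hN
  rw [integral_finsetSum B integrable_indicator] at hle
  simp only [integral_indicator_one (hS _)] at hle
  exact ⟨x, hx, by simpa [indicator_apply] using hle⟩

variable {A : Type u} [TopologicalSpace A]

theorem HasFullySupportedMeasure.exists_mul_card_le_card_filter
    {W : Set (Config A)} (hμ : HasFullySupportedMeasure W) {U : Set (Config A)} (hU : IsOpen U)
    (hUW : (U ∩ W).Nonempty) :
    ∃ δ : ℝ, 0 < δ ∧ ∀ B : Finset (ℤ × ℤ), ∀ v : ℤ × ℤ → ℤ × ℤ, ∃ z ∈ W, ∃ G ⊆ B,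
      (∀ a ∈ G, shift (v a) z ∈ U) ∧ δ * B.card ≤ G.card := by
  classical
  let _ : MeasurableSpace (Config A) := borel (Config A)
  have : BorelSpace (Config A) := ⟨rfl⟩
  obtain ⟨μ, hprob, hinv, hnull, hpos⟩ := hμ
  refine ⟨μ.real U, ENNReal.toReal_pos (hpos U hU hUW).ne' (measure_ne_top _ _), fun B v => ?_⟩
  have measureReal_preimage (a) : μ.real (shift (v a) ⁻¹' U) = μ.real U := by
    rw [← map_measureReal_apply (continuous_shift _).measurable hU.measurableSet, hinv]
  obtain ⟨z, hz, hle⟩ := exists_sum_measureReal_le_card_filter μ hnull B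
    fun a => (hU.preimage (continuous_shift (v a))).measurableSet
  refine ⟨z, not_not.1 hz, _, Finset.filter_subset _ B, fun a ha => (Finset.mem_filter.1 ha).2, ?_⟩
  simpa [measureReal_preimage, mul_comm] using hle

theorem exists_box_of_mem_nhds {y : Config A} {U : Set (Config A)} (hU : U ∈ 𝓝 y) :
    ∃ N, ∀ u, EqOn y u (box N) → u ∈ U := by
  obtain ⟨O, hOU, hO, hyO⟩ := mem_nhds_iff.1 hU
  obtain ⟨I, s, hs, hsO⟩ := isOpen_pi_iff.1 hO y hyO
  obtain ⟨N, hN⟩ := (I.finite_toSet.image fun p => max |p.1| |p.2|).bddAbove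
  refine ⟨N, fun u hu => hOU (hsO fun p hp => ?_)⟩
  have hpN : max |p.1| |p.2| ≤ N := hN (mem_image_of_mem _ hp)
  rw [← hu (mem_box.2 ⟨(le_max_left _ _).trans hpN, (le_max_right _ _).trans hpN⟩)]
  exact (hs p hp).2

end Density

/-! ### Transitivity pairs yield entropy pairs -/

section TransitivityPairs

variable {A : Type u} {W : Set (Config A)}

theorem exists_forall_eqOn_of_mem_transitivityPairs {x : Bool → Config A}
    (hx : (x false, x true) ∈ transitivityPairs W) (F : Finset (ℤ × ℤ)) :
    ∃ w ∈ W, ∃ k : Bool → ℤ × ℤ, ∀ b, EqOn (x b) (fun p => w (p + k b)) F := by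
  obtain ⟨w, hw, ⟨k, hk⟩, ⟨k', hk'⟩⟩ := hx.2.2 ⟨F, fun p => x false p⟩ ⟨F, fun p => x true p⟩
    ⟨0, fun p => by rw [add_zero]⟩ ⟨0, fun p => by rw [add_zero]⟩
  exact ⟨w, hw, fun b => bif b then k' else k,
    Bool.forall_bool.2 ⟨fun p hp => (hk ⟨p, hp⟩).symm, fun p hp => (hk' ⟨p, hp⟩).symm⟩⟩

variable [TopologicalSpace A] [DiscreteTopology A]

theorem isOpen_setOf_forall_eqOn {ι : Type*} [Finite ι] (x : ι → Config A) (k : ι → ℤ × ℤ)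
    (F : Finset (ℤ × ℤ)) :
    IsOpen {w : Config A | ∀ b, EqOn (x b) (fun p => w (p + k b)) F} := by
  simp only [EqOn, ofPred_forall]
  exact isOpen_iInter_of_finite fun b => isOpen_biInter_finset fun p _ =>
    (isOpen_discrete {a | x b p = a}).preimage
      (show Continuous fun w : Config A => w (p + k b) by fun_prop)

theorem exists_isIndependenceSet_fabricSet (hμ : HasFullySupportedMeasure W)
    {x : Bool → Config A} {y : Bool → Config (Symbol A)} {K : Bool → Set (Config (Symbol A))}
    (hx : (x false, x true) ∈ transitivityPairs W) (hy : ∀ b, y b ∈ fabric (x b))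
    (hK : ∀ b, K b ∈ 𝓝[fabricSet W] y b) :
    ∃ δ : ℝ, 0 < δ ∧ ∃ L : ℤ, 0 < L ∧ ∀ B : Finset (ℤ × ℤ), ∃ G ⊆ B,
      IsIndependenceSet shift (fabricSet W) K ((L • ·) '' (G : Set (ℤ × ℤ))) ∧
        δ * B.card ≤ G.card := by
  choose H V hH hV hy using hy
  choose O hO hOK using fun b => mem_nhdsWithin_iff_exists_mem_nhds_inter.1 (hK b)
  choose N hN using fun b => exists_box_of_mem_nhds (hO b)
  obtain ⟨M, hM⟩ := exists_abs_le N
  obtain ⟨I, hI⟩ := exists_abs_le fun b => M + |H b 0 0| + |V b 0 0| + 1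
  obtain ⟨w, hw, k, hwk⟩ := exists_forall_eqOn_of_mem_transitivityPairs hx (box I)
  obtain ⟨δ, hδ, hdensity⟩ := hμ.exists_mul_card_le_card_filter
    (isOpen_setOf_forall_eqOn x k (box I)) ⟨w, hwk, hw⟩
  obtain ⟨L, hL, hweave⟩ :=
    exists_mem_fabric_forall_eqOn hH hV hy (fun b => (le_abs_self _).trans (hI b)) k
  refine ⟨δ, hδ, 3 * L, by positivity, fun B => ?_⟩
  obtain ⟨z, hz, G, hGB, hG, hcard⟩ := hdensity B fun a => L • a
  refine ⟨G, hGB, fun c => ?_, hcard⟩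
  obtain ⟨u, hu, hyu⟩ := hweave z G hG fun a => c ((3 * L) • a)
  have hu : u ∈ fabricSet W := mem_fabricSet.2 ⟨z, hz, hu⟩
  refine ⟨u, hu, forall_mem_image.2 fun a ha => hOK _ ⟨hN _ _ ?_, ?_⟩⟩
  · exact (hyu a ha).mono (box_subset_box ((le_abs_self _).trans (hM _)))
  · obtain ⟨z, hz, hu⟩ := mem_fabricSet.1 hu
    exact mem_fabricSet.2 ⟨z, hz, shift_mem_fabric _ hu⟩

theorem isEntropyPair_of_mem_transitivityPairs (hμ : HasFullySupportedMeasure W)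
    {x x' : Config A} {y y' : Config (Symbol A)} (hx : (x, x') ∈ transitivityPairs W)
    (hy : y ∈ fabric x) (hy' : y' ∈ fabric x') (hne : y ≠ y') :
    IsEntropyPair (fabricSet W) y y' := by
  refine ⟨mem_fabricSet.2 ⟨x, hx.1, hy⟩, mem_fabricSet.2 ⟨x', hx.2.1, hy'⟩, hne,
    fun K K' _ _ hK hK' hdisj => ?_⟩
  have hy : ∀ b, (bif b then y' else y) ∈ fabric (bif b then x' else x) :=
    Bool.forall_bool.2 ⟨hy, hy'⟩
  have hK : ∀ b, (bif b then K' else K) ∈ 𝓝[fabricSet W] bif b then y' else y :=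
    Bool.forall_bool.2 ⟨hK, hK'⟩
  obtain ⟨δ, hδ, L, hL, h⟩ := exists_isIndependenceSet_fabricSet hμ hx hy hK
  exact coverEntropy_pos_of_forall_exists_isIndependenceSet
    (K := fun b => bif b then K' else K) hdisj hδ hL h

theorem fabricRel_transitivityPairs [Finite A] (hW : IsSubshift W)
    (hμ : HasFullySupportedMeasure W) :
    fabricRel (transitivityPairs W) = entropyOrEqual (fabricSet W) := by
  ext ⟨y, y'⟩
  constructor
  · intro h
    obtain ⟨⟨x, x'⟩, hx, hy, hy'⟩ := mem_fabricRel.1 h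
    exact ⟨mem_fabricSet.2 ⟨x, hx.1, hy⟩, mem_fabricSet.2 ⟨x', hx.2.1, hy'⟩,
      or_iff_not_imp_left.2 (isEntropyPair_of_mem_transitivityPairs hμ hx hy hy')⟩
  · rintro ⟨hy : y ∈ _, hy' : y' ∈ _, h : y = y' ∨ _⟩
    obtain ⟨x, hx, hy⟩ := mem_fabricSet.1 hy
    obtain ⟨x', hx', hy'⟩ := mem_fabricSet.1 hy'
    rcases h with rfl | h
    · exact mem_fabricRel.2
        ⟨(x, x), (isShiftTolerance_transitivityPairs hW.shift_mem).refl x hx, hy, ‹_›⟩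
    · exact mem_fabricRel.2
        ⟨(x, x'), mem_transitivityPairs_of_isEntropyPair hW hx hx' hy hy' h, hy, hy'⟩

end TransitivityPairs

/-! ### Completely positive entropy from the hierarchy of entropy pairs -/

section Factors

variable {A : Type u} {X : Set (Config A)}

/-- The kernel of a map `π` defined on `X`, as a relation on the ambient space. -/
def kernelRel {Y : Type*} (π : X → Y) : Set (Config A × Config A) :=
  Prod.map Subtype.val Subtype.val '' {p : X × X | π p.1 = π p.2}

theorem mem_kernelRel {Y : Type*} {π : X → Y} {x y : X} : (x.1, y.1) ∈ kernelRel π ↔ π x = π y :=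
  (Subtype.val_injective.prodMap Subtype.val_injective).mem_set_image (a := (x, y))

theorem isEquivOn_kernelRel {Y : Type*} (π : X → Y) : IsEquivOn X (kernelRel π) := by
  refine ⟨fun x hx => (mem_kernelRel (x := ⟨x, hx⟩)).2 rfl, ?_, ?_⟩
  · rintro _ _ ⟨⟨x, y⟩, hxy : π x = π y, rfl, rfl⟩
    exact mem_kernelRel.2 hxy.symm
  · rintro _ _ _ ⟨⟨x, y⟩, hxy : π x = π y, rfl, rfl⟩ ⟨⟨y', z⟩, hyz : π y' = π z, hy⟩
    obtain rfl : y' = y := Subtype.ext (congrArg Prod.fst hy)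
    obtain rfl : z.1 = _ := congrArg Prod.snd hy
    exact mem_kernelRel.2 (hxy.trans hyz)

variable [TopologicalSpace A]

theorem E_subset {N : Set (Config A × Config A)} (hN : IsClosed N) (hXN : IsEquivOn X N)
    (h : ∀ x y, IsEntropyPair X x y → (x, y) ∈ N) (α : Ordinal.{0}) : E X α ⊆ N := by
  refine levels_induction (Q := fun R => R ⊆ N) ?_ (fun R hR => ?_) (fun _ _ _ => iUnion_subset) α
  · rintro ⟨x, y⟩ ⟨hx : x ∈ X, -, hxy : x = y ∨ _⟩
    rcases hxy with rfl | hxy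
    exacts [hXN.1 _ hx, h _ _ hxy]
  · rw [entropyStep_eq]
    split_ifs
    exacts [transSymmClosure_subset hR hXN, closure_minimal hR hN]

theorem isClosed_kernelRel {Y : Type*} [TopologicalSpace Y] [T2Space Y] (hX : IsClosed X)
    {π : X → Y} (hπ : Continuous π) : IsClosed (kernelRel π) :=
  (hX.isClosedEmbedding_subtypeVal.prodMap hX.isClosedEmbedding_subtypeVal).isClosedMap _
    (isClosed_eq (hπ.comp continuous_fst) (hπ.comp continuous_snd))

theorem coverEntropy_le_topEntropy {Y : Type u} [TopologicalSpace Y] [AddAction (ℤ × ℤ) Y]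
    {𝒰 : Set (Set Y)} (hopen : ∀ U ∈ 𝒰, IsOpen U) (hcover : ⋃₀ 𝒰 = univ) :
    coverEntropy (fun (g : ℤ × ℤ) (y : Y) => g +ᵥ y) univ 𝒰 ≤ topEntropy Y :=
  le_iSup (fun 𝒰 : {𝒰 : Set (Set Y) // (∀ U ∈ 𝒰, IsOpen U) ∧ ⋃₀ 𝒰 = univ} =>
    coverEntropy (fun (g : ℤ × ℤ) (y : Y) => g +ᵥ y) univ 𝒰.1) ⟨𝒰, hopen, hcover⟩

theorem IsEntropyPair.topEntropy_pos {Y : Type u} [TopologicalSpace Y] [T25Space Y]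
    [AddAction (ℤ × ℤ) Y] (hX : IsClosed X) {π : X → Y} (hπ : Continuous π)
    (equivariant : ∀ (g : ℤ × ℤ) (x x' : X), x'.1 = shift g x.1 → π x' = g +ᵥ π x) {x y : X}
    (h : IsEntropyPair X x.1 y.1) (hxy : π x ≠ π y) : 0 < topEntropy Y := by
  obtain ⟨B, hB, B', hB', hdisj⟩ := exists_nhds_disjoint_closure hxy
  have isClosed_pullback {C : Set Y} : IsClosed (Subtype.val '' (π ⁻¹' closure C)) :=
    hX.isClosedEmbedding_subtypeVal.isClosedMap _ (isClosed_closure.preimage hπ)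
  have pullback_mem_nhds {C : Set Y} {z : X} (hC : C ∈ 𝓝 (π z)) :
      Subtype.val '' (π ⁻¹' closure C) ∈ 𝓝[X] z.1 := by
    rw [nhdsWithin_eq_map_subtype_coe z.2]
    exact image_mem_map (hπ.continuousAt (mem_of_superset hC subset_closure))
  have avoid_pullback {C : Set Y} (g : ℤ × ℤ) (z : X) (hz : g +ᵥ π z ∈ (closure C)ᶜ) :
      shift g z ∈ (Subtype.val '' (π ⁻¹' closure C))ᶜ := by
    rintro ⟨w, hw, hwz⟩
    exact hz (equivariant g z w hwz ▸ hw)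
  calc 0 < coverEntropy shift X
        {(Subtype.val '' (π ⁻¹' closure B))ᶜ, (Subtype.val '' (π ⁻¹' closure B'))ᶜ} :=
        h.2.2.2 _ _ isClosed_pullback isClosed_pullback (pullback_mem_nhds hB)
          (pullback_mem_nhds hB') ((disjoint_image_iff Subtype.val_injective).2 (hdisj.preimage π))
    _ ≤ coverEntropy (fun (g : ℤ × ℤ) (y : Y) => g +ᵥ y) univ {(closure B)ᶜ, (closure B')ᶜ} := by
        refine coverEntropy_le_of_lift (toFinite _) (sUnion_pair_compl_eq_univ hdisj)
          (fun z => mem_univ (π z)) ?_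
        rintro _ (rfl | rfl)
        exacts [⟨_, .inl rfl, avoid_pullback⟩, ⟨_, .inr rfl, avoid_pullback⟩]
    _ ≤ topEntropy Y := by
        refine coverEntropy_le_topEntropy ?_ (sUnion_pair_compl_eq_univ hdisj)
        rintro _ (rfl | rfl)
        exacts [isClosed_closure.isOpen_compl, isClosed_closure.isOpen_compl]

theorem hasTCPE_of_E_eq (hX : IsClosed X) {α : Ordinal.{0}} (h : E X α = X ×ˢ X) :
    HasTCPE X := by
  intro Y _ _ _ _ _ π hπ surjective equivariant hY
  by_contra htop
  have E_subset_kernelRel : E X α ⊆ kernelRel π :=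
    E_subset (isClosed_kernelRel hX hπ) (isEquivOn_kernelRel π) (fun x y hxy =>
      (mem_kernelRel (x := ⟨x, hxy.1⟩) (y := ⟨y, hxy.2.1⟩)).2 <| by_contra fun hne =>
        htop (IsEntropyPair.topEntropy_pos hX hπ equivariant hxy hne)) α
  obtain ⟨a, b, hab⟩ := exists_pair_ne Y
  obtain ⟨x, rfl⟩ := surjective a
  obtain ⟨x', rfl⟩ := surjective b
  exact hab (mem_kernelRel.1 (E_subset_kernelRel (h ▸ ⟨x.2, x'.2⟩)))

end Factors

/-! ### Invariant functions on systems with completely positive entropy -/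

section ClosedQuotients

variable {Z : Type*} [TopologicalSpace Z]

theorem isClosedMap_quotientMk [CompactSpace Z] [T2Space Z] {s : Setoid Z}
    (hs : IsClosed {p : Z × Z | s p.1 p.2}) : IsClosedMap (Quotient.mk s) := fun F hF => by
  refine isQuotientMap_quotient_mk'.isClosed_preimage.1 ?_
  have saturation_eq : Quotient.mk s ⁻¹' (Quotient.mk s '' F) =
      Prod.snd '' ({p : Z × Z | s p.1 p.2} ∩ Prod.fst ⁻¹' F) := by
    ext z
    constructor
    · rintro ⟨w, hw, hwz⟩
      exact ⟨(w, z), ⟨Quotient.exact hwz, hw⟩, rfl⟩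
    · rintro ⟨⟨w, z⟩, ⟨hwz, hw⟩, rfl⟩
      exact ⟨w, hw, Quotient.sound hwz⟩
  exact saturation_eq ▸
    ((hs.inter (hF.preimage continuous_fst)).isCompact.image continuous_snd).isClosed

theorem normalSpace_of_isClosedMap {Y : Type*} [TopologicalSpace Y] [NormalSpace Z] {f : Z → Y}
    (hf : IsClosedMap f) (hfc : Continuous f) (hsurj : f.Surjective) : NormalSpace Y := by
  refine ⟨fun C D hC hD hCD => ?_⟩
  obtain ⟨U, V, hU, hV, hCU, hDV, hUV⟩ :=
    normal_separation (hC.preimage hfc) (hD.preimage hfc) (hCD.preimage f)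
  have isOpen_kernImage {U : Set Z} (hU : IsOpen U) : IsOpen (kernImage f U) :=
    isClosedMap_iff_kernImage.1 hf hU
  refine ⟨kernImage f U, kernImage f V, isOpen_kernImage hU, isOpen_kernImage hV,
    subset_kernImage_iff.2 hCU, subset_kernImage_iff.2 hDV, Set.disjoint_left.2 fun y hyU hyV => ?_⟩
  obtain ⟨z, rfl⟩ := hsurj y
  exact hUV.notMem_of_mem_left (hyU rfl) (hyV rfl)

theorem exists_continuous_ne_of_isClosed_setoid [CompactSpace Z] [T2Space Z] {s : Setoid Z}
    (hs : IsClosed {p : Z × Z | s p.1 p.2}) {a b : Z} (hab : ¬ s a b) :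
    ∃ φ : Z → ℝ, Continuous φ ∧ (∀ x y, s x y → φ x = φ y) ∧ φ a ≠ φ b := by
  have hmk := isClosedMap_quotientMk hs
  have : NormalSpace (Quotient s) :=
    normalSpace_of_isClosedMap hmk continuous_quotient_mk' Quotient.mk_surjective
  have isClosed_mk (z : Z) : IsClosed {Quotient.mk s z} := by
    simpa only [image_singleton] using hmk _ (isClosed_singleton (x := z))
  obtain ⟨f, hfa, hfb, -⟩ := exists_continuous_zero_one_of_isClosed (isClosed_mk a) (isClosed_mk b)
    (disjoint_singleton.2 fun h => hab (Quotient.exact h))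
  refine ⟨fun z => f (Quotient.mk s z), f.continuous.comp continuous_quotient_mk',
    fun x y hxy => congrArg f (Quotient.sound hxy), ?_⟩
  exact (hfa rfl).trans_ne (zero_ne_one.trans_eq (hfb rfl).symm)

end ClosedQuotients

section TrivialFactors

theorem topEntropy_nonpos_of_forall_vadd_eq {Y : Type u} [TopologicalSpace Y] [CompactSpace Y]
    [AddAction (ℤ × ℤ) Y] (h : ∀ (g : ℤ × ℤ) (y : Y), g +ᵥ y = y) : topEntropy Y ≤ 0 := by
  classical
  refine iSup_le fun ⟨𝒰, hopen, hcover⟩ => ?_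
  obtain ⟨F, hF⟩ := isCompact_univ.elim_finite_subcover (fun U : 𝒰 => U.1)
    (fun U => hopen U.1 U.2) (by rw [← sUnion_eq_iUnion, hcover])
  refine coverEntropy_nonpos_of_orbits (F := F.image Subtype.val) (by simp) fun y hy => ?_
  obtain ⟨U, hU, hyU⟩ := mem_iUnion₂.1 (hF hy)
  exact ⟨U.1, Finset.mem_image_of_mem _ hU, fun g => by rwa [h]⟩

variable {A : Type u} [TopologicalSpace A] {X : Set (Config A)}

theorem HasTCPE.eq_of_forall_shift_eq (h : HasTCPE X) (hX : IsCompact X) {φ : X → ℝ}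
    (hφ : Continuous φ) (invariant : ∀ (g : ℤ × ℤ) (x x' : X), x'.1 = shift g x.1 → φ x' = φ x)
    (a b : X) : φ a = φ b := by
  by_contra hab
  have : CompactSpace X := isCompact_iff_compactSpace.1 hX
  let Y := ULift.{u} (range φ)
  have : CompactSpace (range φ) := isCompact_iff_compactSpace.1 (isCompact_range hφ)
  have : CompactSpace Y := Homeomorph.ulift.symm.compactSpace
  let _ : AddAction (ℤ × ℤ) Y :=
    { vadd := fun _ y => y
      zero_vadd := fun _ => rfl
      add_vadd := fun _ _ _ => rfl }
  have : ContinuousConstVAdd (ℤ × ℤ) Y := ⟨fun _ => continuous_id⟩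
  let π : X → Y := fun x => ⟨⟨φ x, x, rfl⟩⟩
  refine (h Y π (continuous_uliftUp.comp (hφ.subtype_mk _)) ?_ ?_ ?_).not_ge
    (topEntropy_nonpos_of_forall_vadd_eq fun _ _ => rfl)
  · rintro ⟨⟨_, x, rfl⟩⟩
    exact ⟨x, rfl⟩
  · exact fun g x x' hx => congrArg ULift.up (Subtype.ext (invariant g x x' hx))
  · exact ⟨π a, π b, fun he => hab (congrArg (fun y : Y => (y.down : ℝ)) he)⟩

-- Real-valued functions are used because the quotient by `R` itself is not known to be metrizable.
theorem HasTCPE.eq_prod_of_isEquivOn [T2Space A] (h : HasTCPE X) (hX : IsCompact X)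
    {R : Set (Config A × Config A)} (hRX : R ⊆ X ×ˢ X) (hR : IsEquivOn X R) (hRc : IsClosed R)
    (shift_mem : ∀ g, ∀ x ∈ X, (x, shift g x) ∈ R) : R = X ×ˢ X := by
  refine hRX.antisymm ?_
  rintro ⟨a, b⟩ ⟨ha, hb⟩
  by_contra hab
  have : CompactSpace X := isCompact_iff_compactSpace.1 hX
  let s : Setoid X :=
    ⟨fun x y => (x.1, y.1) ∈ R, fun x => hR.1 x.1 x.2, hR.2.1 _ _, hR.2.2 _ _ _⟩
  have isClosed_s : IsClosed {p : X × X | s p.1 p.2} :=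
    hRc.preimage (f := fun p : X × X => (p.1.1, p.2.1)) (by fun_prop)
  obtain ⟨φ, hφ, hφs, hne⟩ :=
    exists_continuous_ne_of_isClosed_setoid isClosed_s (a := ⟨a, ha⟩) (b := ⟨b, hb⟩) hab
  refine hne (h.eq_of_forall_shift_eq hX hφ (fun g x x' hx => hφs x' x (hR.2.1 _ _ ?_)) _ _)
  exact hx ▸ shift_mem g x.1 x.2

end TrivialFactors

/-! ### Completely positive entropy of the fabric and generalized transitivity -/

section Fabrics

variable {A : Type u} [Finite A] [TopologicalSpace A] [DiscreteTopology A] {W : Set (Config A)}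

theorem fabricRel_T (hW : IsSubshift W) (hμ : HasFullySupportedMeasure W) (α : Ordinal.{0}) :
    fabricRel (T W α) = E (fabricSet W) α := by
  refine (levels_induction₂ (Q := fun R S => IsShiftTolerance W R ∧ fabricRel R = S)
    ⟨isShiftTolerance_transitivityPairs hW.shift_mem,
      fabricRel_transitivityPairs hW hμ⟩ ?_ ?_ α).2
  · rintro R _ ⟨hR, rfl⟩
    exact ⟨hR.transitivityStep hW.isClosed, fabricRel_transitivityStep _ hR⟩
  · intro ι _ R S hRS
    exact ⟨.iUnion fun i => (hRS i).1, by simp only [fabricRel_iUnion, (hRS _).2]⟩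

theorem E_fabricSet_eq_prod_iff (hW : IsSubshift W) (hμ : HasFullySupportedMeasure W)
    (α : Ordinal.{0}) : E (fabricSet W) α = fabricSet W ×ˢ fabricSet W ↔ T W α = W ×ˢ W := by
  rw [← fabricRel_T hW hμ, ← fabricRel_prod,
    fabricRel_inj (isShiftTolerance_T hW α).bishift hW.isBishiftInvariant_prod]

theorem isGeneralizedTransitive_of_hasTCPE (hW : IsSubshift W) (h : HasTCPE (fabricSet W)) :
    IsGeneralizedTransitive W := by
  obtain ⟨α, h1, hα, closed, transitive⟩ := exists_isClosed_transClosure_eq W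
  have hT := isShiftTolerance_T hW α
  refine ⟨α, h1, hα, (fabricRel_inj hT.bishift hW.isBishiftInvariant_prod).1 ?_⟩
  rw [fabricRel_prod]
  refine h.eq_prod_of_isEquivOn (isSubshift_fabricSet hW).isClosed.isCompact
    (fabricRel_prod W ▸ fabricRel_mono hT.subset) (isEquivOn_fabricRel hT transitive)
    (isClosed_fabricRel closed hT.bishift) fun g y hy => ?_
  obtain ⟨x, hx, hy⟩ := mem_fabricSet.1 hy
  exact mem_fabricRel.2 ⟨(x, x), hT.refl x hx, hy, shift_mem_fabric g hy⟩

theorem hasTCPE_fabricSet_iff (hW : IsSubshift W) (hμ : HasFullySupportedMeasure W) :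
    HasTCPE (fabricSet W) ↔ IsGeneralizedTransitive W := by
  refine ⟨isGeneralizedTransitive_of_hasTCPE hW, fun ⟨α, _, _, h⟩ => ?_⟩
  exact hasTCPE_of_E_eq (isSubshift_fabricSet hW).isClosed ((E_fabricSet_eq_prod_iff hW hμ α).2 h)

theorem tcpeRank_fabricSet (hW : IsSubshift W) (hμ : HasFullySupportedMeasure W) :
    tcpeRank (fabricSet W) = transitivityRank W := by
  simp only [tcpeRank, transitivityRank, E_fabricSet_eq_prod_iff hW hμ]

end Fabrics

end Fabric

theorem mainTheorem6 {A : Type*} [Finite A] [TopologicalSpace A] [DiscreteTopology A]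
    (W : Set (Fabric.Config A)) (hW : Fabric.IsSubshift W)
    (hμ : Fabric.HasFullySupportedMeasure W) :
    Fabric.IsSubshift (Fabric.fabricSet W) ∧
    (Fabric.HasTCPE (Fabric.fabricSet W) ↔ Fabric.IsGeneralizedTransitive W) ∧
    (Fabric.IsGeneralizedTransitive W →
      Fabric.tcpeRank (Fabric.fabricSet W) = Fabric.transitivityRank W) ∧
    ∀ α : Ordinal.{0}, 1 ≤ α → α < Ordinal.omega 1 →
      Fabric.fabricRel (Fabric.T W α) = Fabric.E (Fabric.fabricSet W) α := by
  exact ⟨Fabric.isSubshift_fabricSet hW, Fabric.hasTCPE_fabricSet_iff hW hμ,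
    fun _ => Fabric.tcpeRank_fabricSet hW hμ, fun α _ _ => Fabric.fabricRel_T hW hμ α⟩
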